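/- Let $n\ge 1$, and let $N$ be either the unit sphere $S^n\subset\mathbb{R}^{n+1}$ or the torus $T^n=(\mathbb{R}/\mathbb{Z})^n$. Let $X$ be a vector field on $N$ which is the restriction to $S^n$ of a polynomial vector field on $\mathbb{R}^{n+1}$ tangent to $S^n$ (if $N=S^n$), or a trigonometric polynomial $X(x)=\sum_k \big(a_k\sin(2\pi k\cdot x)+b_k\cos(2\pi k\cdot x)\big)$, a finite sum over $k\in\mathbb{Z}^n$ with $a_k,b_k\in\mathbb{R}^n$ (if $N=T^n$). Let $\phi_X^t$, $t\in\mathbb{R}$, be the flow of $X$. Then there are an integer $d$, a compact smooth Riemannian manifold $(M,g)$ with $M$ diffeomorphic to $SO(d)\times T^d$, a finite-dimensional linear space $E$ of smooth divergence-free vector fields on $M$, and a map $\Phi:N\to E$ which is a smooth embedding when $E$ carries the $C^k$ topology of vector fields, for every $0\le k\le\infty$, such that for every $x\in N$ the time-dependent vector field $u_t=\Phi(\phi_X^t(x))$ is, for all $t\in\mathbb{R}$, a smooth solution of the Euler equations $$\partial_t u_t+\nabla_{u_t}u_t=-\nabla p_t,\qquad \operatorname{div}u_t=0$$ on $M$,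 with some smooth pressure $p$ and with initial condition $u_0=\Phi(x)$. Here the first $\nabla$ is the Levi-Civita connection of $g$, and $\nabla p$ and $\operatorname{div}$ are the gradient and the divergence with respect to $g$. -/

import Mathlib

open Set Filter Topology Manifold
open scoped ContDiff

/-! ## The flat torus `(ℝ/ℤ)^n` as a smooth manifold -/

/-- The quotient projection `ℝ^n → (ℝ/ℤ)^n`. -/
def torusMk (n : ℕ) (y : Fin n → ℝ) : UnitAddTorus (Fin n) := fun i => (y i : UnitAddCircle)

theorem torusMk_surjective (n : ℕ) : Function.Surjective (torusMk n) := by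
  intro q
  choose y hy using fun i => QuotientAddGroup.mk_surjective (q i)
  exact ⟨y, funext hy⟩

theorem torusMk_isLocalHomeomorph (n : ℕ) : IsLocalHomeomorph (torusMk n) := by
  intro y
  choose e he he' using fun i : Fin n => AddCircle.isLocalHomeomorph_coe (1 : ℝ) (y i)
  refine ⟨OpenPartialHomeomorph.pi e, fun i _ => he i, ?_⟩
  funext z i
  exact congrFun (he' i) (z i)

/-- The charts of the torus are the local inverses of the projection `ℝ^n → (ℝ/ℤ)^n`. -/
noncomputable instance torusChartedSpace (n : ℕ) :
    ChartedSpace (Fin n → ℝ) (UnitAddTorus (Fin n)) :=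
  (torusMk_isLocalHomeomorph n).chartedSpace (torusMk_surjective n)

theorem torus_chart_symm (n : ℕ) {e : OpenPartialHomeomorph (UnitAddTorus (Fin n)) (Fin n → ℝ)}
    (he : e ∈ atlas (Fin n → ℝ) (UnitAddTorus (Fin n))) (y : Fin n → ℝ) :
    e.symm y = torusMk n y := by
  obtain ⟨q, rfl⟩ := he
  simp only [OpenPartialHomeomorph.coe_trans_symm, Function.comp_apply,
    IsLocalHomeomorph.localInverseAt_symm]
  rfl

/-- Two lifts of the same point of the torus differ by an integer vector, so a continuous change
of lift is locally a translation. -/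
theorem torus_lift_eventually (n : ℕ) (f : (Fin n → ℝ) → (Fin n → ℝ)) (x : Fin n → ℝ)
    (hf : ContinuousAt f x) (h : ∀ᶠ y in 𝓝 x, torusMk n (f y) = torusMk n y) :
    ∀ᶠ y in 𝓝 x, f y = y + (f x - x) := by
  have key : ∀ y, torusMk n (f y) = torusMk n y → ∀ i, ∃ m : ℤ, f y i - y i = m := by
    intro y hy i
    have h1 : ((f y i : ℝ) : UnitAddCircle) = (y i : UnitAddCircle) := congrFun hy i
    have h2 : ((f y i - y i : ℝ) : UnitAddCircle) = 0 := by
      rw [AddCircle.coe_sub, h1, sub_self]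
    obtain ⟨m, hm⟩ := (AddCircle.coe_eq_zero_iff (1 : ℝ)).1 h2
    exact ⟨m, by simpa using hm.symm⟩
  have hx := key x h.self_of_nhds
  have hc : ContinuousAt (fun y => f y - y) x := hf.sub continuousAt_id
  have hb : ∀ᶠ y in 𝓝 x, dist (f y - y) (f x - x) < 1 :=
    hc.eventually (Metric.ball_mem_nhds _ one_pos)
  filter_upwards [h, hb] with y hy hyb
  have : f y - y = f x - x := by
    funext i
    obtain ⟨m, hm⟩ := key y hy i
    obtain ⟨k, hk⟩ := hx i
    have hd : dist ((f y - y) i) ((f x - x) i) < 1 := lt_of_le_of_lt (dist_le_pi_dist _ _ i) hyb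
    simp only [Pi.sub_apply, hm, hk, Int.dist_cast_real] at hd ⊢
    rw [Int.dist_eq] at hd
    have : |m - k| < 1 := by exact_mod_cast hd
    have : m = k := by rw [Int.abs_lt_one_iff] at this; omega
    rw [this]
  rw [← this]; abel

instance torusIsManifold (n : ℕ) :
    IsManifold 𝓘(ℝ, Fin n → ℝ) ∞ (UnitAddTorus (Fin n)) := by
  apply isManifold_of_contDiffOn
  intro e e' he he'
  simp only [modelWithCornersSelf_coe, modelWithCornersSelf_coe_symm, Function.comp_id,
    Function.id_comp, preimage_id, range_id, inter_univ]
  intro x hx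
  apply ContDiffAt.contDiffWithinAt
  have hopen : (e.symm ≫ₕ e').source ∈ 𝓝 x := (e.symm ≫ₕ e').open_source.mem_nhds hx
  have hlift : ∀ᶠ y in 𝓝 x, torusMk n ((e.symm ≫ₕ e') y) = torusMk n y := by
    filter_upwards [hopen] with y hy
    rw [← torus_chart_symm n he', ← torus_chart_symm n he]
    exact e'.left_inv (by simpa using (mem_inter_iff _ _ _).1 hy |>.2)
  have h := torus_lift_eventually n _ x ((e.symm ≫ₕ e').continuousAt hx) hlift
  exact (contDiffAt_id.add contDiffAt_const).congr_of_eventuallyEq h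

/-- The projection `ℝ^n → (ℝ/ℤ)^n` is smooth. -/
theorem torusMk_contMDiff (n : ℕ) :
    ContMDiff 𝓘(ℝ, Fin n → ℝ) 𝓘(ℝ, Fin n → ℝ) ∞ (torusMk n) := by
  intro x
  rw [contMDiffAt_iff]
  have hc := (torusMk_isLocalHomeomorph n).continuous
  refine ⟨hc.continuousAt, ?_⟩
  simp only [mfld_simps, contDiffWithinAt_univ]
  set e := chartAt (Fin n → ℝ) (torusMk n x) with he
  have hs : torusMk n x ∈ e.source := mem_chart_source _ _
  have hl : ∀ᶠ y in 𝓝 x, torusMk n ((e ∘ torusMk n) y) = torusMk n y := by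
    filter_upwards [hc.continuousAt.eventually (e.open_source.mem_nhds hs)] with y hy
    rw [← torus_chart_symm n (chart_mem_atlas _ _)]
    exact e.left_inv hy
  have h := torus_lift_eventually n _ x
    (ContinuousAt.comp (f := torusMk n) (g := e) (e.continuousAt hs) hc.continuousAt) hl
  exact (contDiffAt_id.add contDiffAt_const).congr_of_eventuallyEq h

/-! ## Polynomial vector fields on `S^n` and `T^n` -/

/-- The `n`-sphere, as the unit sphere of `ℝ^(n+1)`. -/
abbrev NSphere (n : ℕ) : Type := Metric.sphere (0 : EuclideanSpace ℝ (Fin (n + 1))) 1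

/-- The vector field `X` on `S^n` is the restriction of a vector field on `ℝ^(n+1)` with
polynomial components. -/
def IsPolynomialField (n : ℕ) (X : (x : NSphere n) → TangentSpace (𝓡 n) x) : Prop :=
  ∃ P : Fin (n + 1) → MvPolynomial (Fin (n + 1)) ℝ, ∀ x : NSphere n, ∀ i : Fin (n + 1),
    mvfderiv (𝓡 n) (fun z : NSphere n => (z : EuclideanSpace ℝ (Fin (n + 1)))) x (X x) i =
      MvPolynomial.eval (fun j => (x : EuclideanSpace ℝ (Fin (n + 1))) j) (P i)

/-- The vector field `X` on `T^n = ℝ^n/ℤ^n` is a trigonometric polynomial: it is the image, under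
the projection, of `y ↦ ∑ₖ sin(2π k·y) aₖ + cos(2π k·y) bₖ`, a finite sum over frequencies
`k ∈ ℤ^n` with `aₖ, bₖ ∈ ℝ^n`. -/
def IsTrigPolynomialField (n : ℕ)
    (X : (x : UnitAddTorus (Fin n)) → TangentSpace 𝓘(ℝ, Fin n → ℝ) x) : Prop :=
  ∃ (s : Finset (Fin n → ℤ)) (a b : (Fin n → ℤ) → (Fin n → ℝ)), ∀ y : Fin n → ℝ,
    X (torusMk n y) = mfderiv 𝓘(ℝ, Fin n → ℝ) 𝓘(ℝ, Fin n → ℝ) (torusMk n) y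
      (∑ k ∈ s, (Real.sin (2 * Real.pi * ∑ i, (k i : ℝ) * y i) • a k +
        Real.cos (2 * Real.pi * ∑ i, (k i : ℝ) * y i) • b k) : Fin n → ℝ)

/-! ## Flows and embeddings -/

section Manifolds

variable {F H N : Type} [NormedAddCommGroup F] [NormedSpace ℝ F] [TopologicalSpace H]
  {I : ModelWithCorners ℝ F H} [TopologicalSpace N] [ChartedSpace H N]

/-- `φ t x = φ_X^t(x)` is the flow of the vector field `X`, defined for all times. -/
def IsGlobalFlow (X : (x : N) → TangentSpace I x) (φ : ℝ → N → N) : Prop :=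
  (∀ x, φ 0 x = x) ∧ ∀ x, IsMIntegralCurve (fun t => φ t x) X

variable (I) in
/-- Smooth embeddings of a (finite-dimensional) manifold in a normed space: smooth maps with
everywhere injective differential which are homeomorphisms onto their image. -/
structure IsSmoothEmbeddingIn {W : Type} [NormedAddCommGroup W] [NormedSpace ℝ W]
    (f : N → W) : Prop where
  smooth : ContMDiff I 𝓘(ℝ, W) ∞ f
  injective_mfderiv : ∀ x, Function.Injective (mfderiv I 𝓘(ℝ, W) f x)
  isEmbedding : IsEmbedding f

end Manifolds

/-! ## Compact Riemannian manifolds -/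

/-- A compact (boundaryless, Hausdorff) smooth manifold with a smooth Riemannian metric. -/
structure CompactRiemannianManifold where
  /-- the vector space in which the charts take values -/
  E : Type
  [normedAddCommGroup : NormedAddCommGroup E]
  [normedSpace : NormedSpace ℝ E]
  [finiteDimensional : FiniteDimensional ℝ E]
  /-- the points of the manifold -/
  M : Type
  [topologicalSpace : TopologicalSpace M]
  [t2Space : T2Space M]
  [compactSpace : CompactSpace M]
  [chartedSpace : ChartedSpace E M]
  [isManifold : IsManifold 𝓘(ℝ, E) ∞ M]
  /-- the Riemannian metric -/
  g : Bundle.ContMDiffRiemannianMetric 𝓘(ℝ, E) ∞ E (fun x : M => TangentSpace 𝓘(ℝ, E) x)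

namespace CompactRiemannianManifold

attribute [instance] normedAddCommGroup normedSpace finiteDimensional topologicalSpace t2Space
  compactSpace chartedSpace isManifold

variable (R : CompactRiemannianManifold)

instance : CompleteSpace R.E := FiniteDimensional.complete ℝ R.E

/-- The tangent space of `R` at a point. -/
abbrev TM (x : R.M) : Type := TangentSpace 𝓘(ℝ, R.E) x

/-- Smooth vector fields on `R`. -/
abbrev VF : Type := ContMDiffSection 𝓘(ℝ, R.E) R.E ∞ R.TM

/-- Connections (covariant derivatives) on the tangent bundle of `R`; `nabla Y x v` is the
derivative `∇_v Y` at `x`. -/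
abbrev Connection : Type := CovariantDerivative 𝓘(ℝ, R.E) R.E R.TM

variable {R}

/-- The vector field `Y` is differentiable at the point `x`. -/
def IsDiffAt (Y : (y : R.M) → R.TM y) (x : R.M) : Prop :=
  MDifferentiableAt 𝓘(ℝ, R.E) 𝓘(ℝ, R.E).tangent
    (fun y => (⟨y, Y y⟩ : TangentBundle 𝓘(ℝ, R.E) R.M)) x

/-- The connection is the Levi-Civita connection: it is torsion-free and compatible with the
metric, `d(g(Y, Z))(v) = g(∇_v Y, Z) + g(Y, ∇_v Z)`. -/
def IsLeviCivita (nabla : R.Connection) : Prop :=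
  nabla.torsion = 0 ∧
  ∀ (x : R.M) (v : R.TM x) (Y Z : (y : R.M) → R.TM y),
    IsDiffAt Y x → IsDiffAt Z x →
      mvfderiv 𝓘(ℝ, R.E) (fun y => R.g.inner y (Y y) (Z y)) x v =
        R.g.inner x (nabla Y x v) (Z x) + R.g.inner x (Y x) (nabla Z x v)

/-- The divergence `div u = tr (v ↦ ∇_v u)`. -/
noncomputable def divergence (nabla : R.Connection) (u : (x : R.M) → R.TM x) (x : R.M) : ℝ :=
  LinearMap.trace ℝ (R.TM x) (nabla u x : R.TM x →ₗ[ℝ] R.TM x)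

/-- The space of smooth divergence-free vector fields. -/
def divFree (nabla : R.Connection) : Submodule ℝ R.VF where
  carrier := {u | ∀ x, divergence nabla u x = 0}
  zero_mem' := by
    intro x
    simp [divergence, ContMDiffSection.coe_zero]
  add_mem' := by
    intro u v hu hv x
    have hu' : IsDiffAt (u : (x : R.M) → R.TM x) x := u.mdifferentiableAt
    have hv' : IsDiffAt (v : (x : R.M) → R.TM x) x := v.mdifferentiableAt
    have h := nabla.isCovariantDerivativeOnUniv.add hu' hv'
    have e : divergence nabla (u + v : R.VF) x = divergence nabla u x + divergence nabla v x := by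
      simp only [divergence, ContMDiffSection.coe_add]
      rw [h]
      simp
    rw [e, hu x, hv x, add_zero]
  smul_mem' := by
    intro c u hu x
    have hu' : IsDiffAt (u : (x : R.M) → R.TM x) x := u.mdifferentiableAt
    have h := nabla.isCovariantDerivativeOnUniv.smul_const c hu'
    have e : divergence nabla (c • u : R.VF) x = c * divergence nabla u x := by
      simp only [divergence, ContMDiffSection.coe_smul]
      rw [h]
      simp
    rw [e, hu x, mul_zero]

/-- `G` is the gradient of the function `p`: `g(G, v) = dp(v)`. -/
def IsGradient (p : R.M → ℝ) (G : (x : R.M) → R.TM x) : Prop :=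
  ∀ (x : R.M) (v : R.TM x), R.g.inner x (G x) v = mvfderiv 𝓘(ℝ, R.E) p x v

/-- `u` is a smooth solution, for all times `t ∈ ℝ`, of the incompressible Euler equations
`∂ₜ u + ∇_u u = -∇p`, `div u = 0`, for some smooth pressure `p`. -/
structure IsEulerSolution (nabla : R.Connection) (u : ℝ → (x : R.M) → R.TM x) : Prop where
  smooth : ContMDiff (𝓘(ℝ, ℝ).prod 𝓘(ℝ, R.E)) 𝓘(ℝ, R.E).tangent ∞
    (fun q : ℝ × R.M => (⟨q.2, u q.1 q.2⟩ : TangentBundle 𝓘(ℝ, R.E) R.M))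
  div_eq_zero : ∀ t x, divergence nabla (u t) x = 0
  momentum : ∃ (p : ℝ → R.M → ℝ) (G : ℝ → (x : R.M) → R.TM x),
    ContMDiff (𝓘(ℝ, ℝ).prod 𝓘(ℝ, R.E)) 𝓘(ℝ, ℝ) ∞ (fun q : ℝ × R.M => p q.1 q.2) ∧
    (∀ t, IsGradient (p t) (G t)) ∧
    ∀ (t : ℝ) (x : R.M), ∃ w : R.TM x,
      HasDerivAt (fun s => u s x) w t ∧ w + nabla (u t) x (u t x) = - G t x

/-! ### The `C^k` topologies on vector fields -/

/-- The components of the vector field `u` in the chart centred at `x₀`. -/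
noncomputable def localRep (u : R.VF) (x₀ : R.M) (y : R.E) : R.E :=
  (trivializationAt R.E R.TM x₀
    ⟨(extChartAt 𝓘(ℝ, R.E) x₀).symm y, u ((extChartAt 𝓘(ℝ, R.E) x₀).symm y)⟩).2

variable (R) in
/-- The `C^k` topology on smooth vector fields, `0 ≤ k ≤ ∞`: uniform convergence, on compact
subsets of the charts, of all the derivatives of order `≤ k` of the components. -/
noncomputable abbrev ckTopology (k : ℕ∞) : TopologicalSpace R.VF :=
  ⨅ (x₀ : R.M) (j : ℕ) (_ : (j : ℕ∞) ≤ k),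
    TopologicalSpace.induced
      (fun u => UniformOnFun.ofFun {K : Set R.E | IsCompact K ∧ K ⊆ (extChartAt 𝓘(ℝ, R.E) x₀).target}
        (iteratedFDeriv ℝ j (localRep u x₀)))
      inferInstance

/-- `Φ : N → E` is a smooth embedding in a finite-dimensional space `E` of vector fields equipped
with the `C^k` topology: there is a linear homeomorphism `L` from `E` with this topology to some
`ℝ^m` (the coordinates in a basis) such that `L ∘ Φ` is a smooth embedding. -/
def IsSmoothEmbeddingCk {F H N : Type} [NormedAddCommGroup F] [NormedSpace ℝ F]
    [TopologicalSpace H] (I : ModelWithCorners ℝ F H) [TopologicalSpace N] [ChartedSpace H N]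
    (k : ℕ∞) (E : Submodule ℝ R.VF) (Φ : N → E) : Prop :=
  ∃ (m : ℕ) (L : E ≃ₗ[ℝ] (Fin m → ℝ)),
    @IsHomeomorph E (Fin m → ℝ) (TopologicalSpace.induced Subtype.val (ckTopology R k)) _ L ∧
    IsSmoothEmbeddingIn I (fun x => L (Φ x))

variable (R) in
/-- `R` is diffeomorphic to `SO(d) × T^d`: there is a smooth embedding of `R` in
`Mat_d(ℝ) × ℂ^d` with image the product of `SO(d)` and `d` unit circles. -/
def IsSOTorus (d : ℕ) : Prop :=
  ∃ j : R.M → (Fin d → Fin d → ℝ) × (Fin d → ℂ), IsSmoothEmbeddingIn 𝓘(ℝ, R.E) j ∧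
    range j = {q | Matrix.of q.1 ∈ Matrix.specialOrthogonalGroup (Fin d) ℝ ∧ ∀ i, ‖q.2 i‖ = 1}

end CompactRiemannianManifold

open CompactRiemannianManifold in
/-- The dynamics of the vector field `X` on `N` embeds, without perturbation, in the Euler
equations of a compact Riemannian manifold `SO(d) × T^d`: there are a finite-dimensional space `E`
of smooth divergence-free vector fields and a smooth embedding `Φ : N → E`, in every `C^k`
topology, such that `t ↦ Φ(φ_X^t(x))` is the Euler solution with initial velocity `Φ(x)`. -/
def EmbedsInEuler {F H N : Type} [NormedAddCommGroup F] [NormedSpace ℝ F] [TopologicalSpace H]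
    (I : ModelWithCorners ℝ F H) [TopologicalSpace N] [ChartedSpace H N]
    (X : (x : N) → TangentSpace I x) : Prop :=
  ∃ (d : ℕ) (R : CompactRiemannianManifold) (nabla : R.Connection) (E : Submodule ℝ R.VF)
    (Φ : N → E) (φ : ℝ → N → N),
    R.IsSOTorus d ∧ IsLeviCivita nabla ∧ FiniteDimensional ℝ E ∧ E ≤ divFree nabla ∧
    (∀ k : ℕ∞, IsSmoothEmbeddingCk I k E Φ) ∧
    IsGlobalFlow X φ ∧
    ∀ x : N, IsEulerSolution nabla (fun t => (Φ (φ t x) : R.VF)) ∧ Φ (φ 0 x) = Φ x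

/-!
# Polynomial flows on spheres and tori inside the Euler equations

The dynamics of `X` on `N` is first put in the form of a quadratic system. A finite family of
functions `f : N → ℝ^d` is chosen which is an embedding of `N` and satisfies `X f = a(f) f`, where
`a : ℝ^d → 𝔰𝔬(d)` is *linear*; thus `y = f(φ^t x)` solves `y' = a(y) y`.

* On the torus, `f` consists of the functions `cos 2πk·x`, `sin 2πk·x`. The field `X` rotates each
  such pair with angular speed `2πk·X(x)`, and the components of `X` are linear combinations of the
  family as soon as it contains the frequencies of `X` (`embedsInEuler_torus`).
* On the sphere, tangency gives `X(x) = Ω(x) x` with `Ω = P xᵀ - x Pᵀ` skew, where `P` is a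
  polynomial vector field extending `X`. The family consists of the products of `m` factors taken
  among `1, x₀, …, xₙ`, that is, the entries of `(1, x)^{⊗ m}`. The matrix `Ω` acts on them as a
  derivation, so again by a skew matrix, and for large `m` its entries are linear combinations of
  the family (`embedsInEuler_sphere`).

Conversely, every quadratic system `y' = a(y) y` of this kind is carried by Euler flows
(`embedsInEuler_of_skew`). Let `M = SO(d) × T^d ⊂ Mat_d(ℝ) × ℂ^d`, with the global frame indexed by
`(Ω, y) ∈ 𝔰𝔬(d) × ℝ^d` whose value at `(Q, z)` is `(Q (Ω - a(y)), (i (Q y)_k z_k)_k)`. For `a = 0`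
these fields bracket as the Lie algebra of rigid motions; the linear substitution
`Ω ↦ Ω - a(y)` preserves constancy of the structure constants, so `M` is locally a unimodular Lie
group. It is given the metric making the frame orthonormal for the trace inner product. The
Koszul formula then yields constant connection coefficients `Γ` (`exists_koszul`); frame fields
with constant components are divergence free by unimodularity, and `⟨∇_u u, w⟩ = -⟨u, [u, w]⟩`.
For `u = (0, y)` the right-hand side pairs `y` with `a(y) y_w` and with a skew matrix applied to
`y`, and therefore `∇_u u = -(0, a(y) y)`. Hence `t ↦ (0, y(t))` solves the Euler equations with zero
pressure.

Charts of `M` are Cayley transforms in the frame directions (`FramedSubmanifold.ofCayley`). The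
tangent space at a point is identified with the components in the frame, so that connection,
divergence and `C^k` topology of the frame fields can be computed on constants.
-/

/-! ### Submanifolds of a normed space with a global frame -/

/-- A submanifold of the normed space `W` whose tangent bundle is trivialized by a global frame: at
the point `q` the tangent space is the image of the injective linear map `frame q : E → W`. It is
given by a parametrization centred at every point, whose differential at the origin is the frame at
this point. The frame is extended to a smooth map on all of `W`, and parametrizations are defined
on the whole of `E`, which costs nothing for the Cayley transform and makes every chart surjective. -/
structure FramedSubmanifold (E W : Type) [NormedAddCommGroup E] [NormedSpace ℝ E]
    [NormedAddCommGroup W] [NormedSpace ℝ W] where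
  /-- the points of the submanifold -/
  carrier : Set W
  /-- the frame; only its values on the carrier matter -/
  frame : W → E →L[ℝ] W
  /-- the parametrization centred at a point -/
  param : carrier → E → W
  /-- the domain of the left inverse of the parametrization -/
  nbhd : carrier → Set W
  /-- a left inverse of the parametrization -/
  coord : carrier → W → E
  contDiff_frame : ContDiff ℝ ∞ frame
  contDiff_param : ∀ q, ContDiff ℝ ∞ (param q)
  param_mem : ∀ q s, param q s ∈ carrier
  param_mem_nbhd : ∀ q s, param q s ∈ nbhd q
  param_zero : ∀ q, param q 0 = q
  hasFDerivAt_param : ∀ q, HasFDerivAt (param q) (frame q) 0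
  isOpen_nbhd : ∀ q, IsOpen (nbhd q)
  contDiffOn_coord : ∀ q, ContDiffOn ℝ ∞ (coord q) (nbhd q)
  coord_param : ∀ q s, coord q (param q s) = s
  param_coord : ∀ q, ∀ w ∈ carrier, w ∈ nbhd q → param q (coord q w) = w

namespace FramedSubmanifold

variable {E W : Type} [NormedAddCommGroup E] [NormedSpace ℝ E]
  [NormedAddCommGroup W] [NormedSpace ℝ W] (S : FramedSubmanifold E W)

/-- The chart centred at `q`. -/
def chart (q : S.carrier) : OpenPartialHomeomorph S.carrier E where
  toFun p := S.coord q p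
  invFun s := ⟨S.param q s, S.param_mem q s⟩
  source := Subtype.val ⁻¹' S.nbhd q
  target := univ
  map_source' _ _ := mem_univ _
  map_target' s _ := S.param_mem_nbhd q s
  left_inv' p hp := Subtype.ext (S.param_coord q p p.2 hp)
  right_inv' s _ := S.coord_param q s
  open_source := (S.isOpen_nbhd q).preimage continuous_subtype_val
  open_target := isOpen_univ
  continuousOn_toFun := (S.contDiffOn_coord q).continuousOn.comp
    continuous_subtype_val.continuousOn (fun _ h => h)
  continuousOn_invFun := ((S.contDiff_param q).continuous.subtype_mk _).continuousOn

theorem mem_nbhd_self (q : S.carrier) : (q : W) ∈ S.nbhd q := by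
  have := S.param_mem_nbhd q 0
  rwa [S.param_zero] at this

/-- The preferred chart at `q` is centred at `q` and tangent to the frame there, so a vector of
`TangentSpace 𝓘(ℝ, E) q`, which is by definition an element of `E`, is the tuple of its
components in the frame. -/
instance : ChartedSpace E S.carrier where
  atlas := range S.chart
  chartAt := S.chart
  mem_chart_source := S.mem_nbhd_self
  chart_mem_atlas q := mem_range_self q

theorem chartAt_eq (q : S.carrier) : chartAt E q = S.chart q := rfl

theorem coord_self (q : S.carrier) : S.coord q q = 0 := by
  conv_lhs => rw [← S.param_zero q, S.coord_param]

theorem coord_contDiffAt (q : S.carrier) {w : W} (hw : w ∈ S.nbhd q) :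
    ContDiffAt ℝ ∞ (S.coord q) w :=
  (S.contDiffOn_coord q).contDiffAt ((S.isOpen_nbhd q).mem_nhds hw)

theorem coord_differentiableAt (q : S.carrier) {w : W} (hw : w ∈ S.nbhd q) :
    DifferentiableAt ℝ (S.coord q) w :=
  (S.coord_contDiffAt q hw).differentiableAt (by simp)

instance : IsManifold 𝓘(ℝ, E) ∞ S.carrier := by
  apply isManifold_of_contDiffOn
  rintro _ _ ⟨p, rfl⟩ ⟨q, rfl⟩
  simp only [modelWithCornersSelf_coe, modelWithCornersSelf_coe_symm, Function.comp_id,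
    Function.id_comp, preimage_id, range_id, inter_univ]
  intro s hs
  have hs' : S.param p s ∈ S.nbhd q := hs.2
  exact ((S.coord_contDiffAt q hs').comp s (S.contDiff_param p).contDiffAt).contDiffWithinAt

theorem extChartAt_apply (q p : S.carrier) : extChartAt 𝓘(ℝ, E) q p = S.coord q p := rfl

theorem extChartAt_target (q : S.carrier) : (extChartAt 𝓘(ℝ, E) q).target = univ := by
  rw [_root_.extChartAt_target]
  simp [chartAt_eq, chart]

/-- The differential of the inclusion sends a tangent vector with components `v` to
`S.frame q v`. -/
theorem hasMFDerivAt_coe (q : S.carrier) :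
    HasMFDerivAt 𝓘(ℝ, E) 𝓘(ℝ, W) (Subtype.val : S.carrier → W) q (S.frame q) := by
  refine ⟨continuous_subtype_val.continuousAt, ?_⟩
  have : writtenInExtChartAt 𝓘(ℝ, E) 𝓘(ℝ, W) q (Subtype.val : S.carrier → W) = S.param q := by
    ext s; rfl
  rw [this, extChartAt_apply, coord_self]
  exact (S.hasFDerivAt_param q).hasFDerivWithinAt

theorem contMDiff_coe : ContMDiff 𝓘(ℝ, E) 𝓘(ℝ, W) ∞ (Subtype.val : S.carrier → W) := by
  intro q
  rw [contMDiffAt_iff]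
  refine ⟨continuous_subtype_val.continuousAt, ?_⟩
  exact ((S.contDiff_param q).contDiffAt).contDiffWithinAt

/-- The coordinate change, at the point `w`, from the components in the frame to the components in
the chart centred at `q`. -/
noncomputable def transition (q : S.carrier) (w : W) : E →L[ℝ] E :=
  (fderiv ℝ (S.coord q) w).comp (S.frame w)

theorem transition_self (q : S.carrier) : S.transition q q = .id ℝ E := by
  have h := ((S.coord_differentiableAt q
    (S.mem_nbhd_self q)).hasFDerivAt (x := (q : W)))
  rw [← S.param_zero q] at h
  have h2 := h.comp 0 (S.hasFDerivAt_param q)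
  have h3 : (S.coord q ∘ S.param q) = id := funext (S.coord_param q)
  rw [h3] at h2
  have := h2.unique (hasFDerivAt_id 0)
  rw [S.param_zero q] at this
  exact this

theorem contDiffOn_transition (q : S.carrier) : ContDiffOn ℝ ∞ (S.transition q) (S.nbhd q) := by
  apply ContDiffOn.clm_comp
  · exact (S.contDiffOn_coord q).fderiv_of_isOpen (S.isOpen_nbhd q) (by simp)
  · exact S.contDiff_frame.contDiffOn

/-- The coordinate changes of Mathlib's tangent bundle are the maps `S.transition`. -/
theorem tangentCoordChange_eq {q p : S.carrier} (hp : (p : W) ∈ S.nbhd q) :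
    tangentCoordChange 𝓘(ℝ, E) p q p = S.transition q p := by
  rw [tangentCoordChange_def]
  simp only [modelWithCornersSelf_coe, range_id, fderivWithin_univ]
  rw [extChartAt_apply, coord_self]
  have h : HasFDerivAt (extChartAt 𝓘(ℝ, E) q ∘ (extChartAt 𝓘(ℝ, E) p).symm)
      (S.transition q p) 0 := by
    have h1 : HasFDerivAt (S.coord q) (fderiv ℝ (S.coord q) p) (S.param p 0) := by
      rw [S.param_zero p]
      exact (S.coord_differentiableAt q hp).hasFDerivAt
    exact h1.comp 0 (S.hasFDerivAt_param p)
  exact h.fderiv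

theorem trivializationAt_snd {q p : S.carrier} (hp : (p : W) ∈ S.nbhd q) (v : E) :
    (trivializationAt E (TangentSpace 𝓘(ℝ, E)) q
      (⟨p, v⟩ : TangentBundle 𝓘(ℝ, E) S.carrier)).2 = S.transition q p v := by
  rw [← S.tangentCoordChange_eq hp]
  rfl

theorem isInvertible_transition {q p : S.carrier} (hp : (p : W) ∈ S.nbhd q) :
    (S.transition q p).IsInvertible := by
  have h1 : p ∈ (chartAt E q).source := hp
  have h2 : p ∈ (chartAt E p).source := mem_chart_source E p
  refine ⟨ContinuousLinearEquiv.equivOfInverse (S.transition q p)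
    (tangentCoordChange 𝓘(ℝ, E) q p p) ?_ ?_, rfl⟩
  · intro v
    rw [← S.tangentCoordChange_eq hp, tangentCoordChange_comp, tangentCoordChange_self]
    · simp
    · simp [h1, h2]
  · intro v
    rw [← S.tangentCoordChange_eq hp, tangentCoordChange_comp, tangentCoordChange_self]
    · simpa using h1
    · simp [h1, h2]

theorem injective_frame (q : S.carrier) : Function.Injective (S.frame q) := by
  have h := S.transition_self q
  intro v w hvw
  have hv : S.transition q q v = v := by rw [h]; rfl
  have hw : S.transition q q w = w := by rw [h]; rfl
  rw [← hv, ← hw]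
  simp only [transition, ContinuousLinearMap.comp_apply, hvw]

theorem eventually_mem_nbhd (q : S.carrier) : ∀ᶠ p : S.carrier in 𝓝 q, (p : W) ∈ S.nbhd q :=
  continuous_subtype_val.continuousAt.eventually
    ((S.isOpen_nbhd _).mem_nhds (S.mem_nbhd_self _))

theorem contMDiffAt_transition (q : S.carrier) :
    ContMDiffAt 𝓘(ℝ, E) 𝓘(ℝ, E →L[ℝ] E) ∞ (fun p : S.carrier => S.transition q p) q :=
  ((S.contDiffOn_transition q).contDiffAt
    ((S.isOpen_nbhd _).mem_nhds (S.mem_nbhd_self _))).contMDiffAt.comp q S.contMDiff_coe.contMDiffAt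

theorem contMDiffAt_inverse_transition [CompleteSpace E] (q : S.carrier) :
    ContMDiffAt 𝓘(ℝ, E) 𝓘(ℝ, E →L[ℝ] E) ∞ (fun p : S.carrier => (S.transition q p).inverse) q :=
  ContMDiffAt.comp q (S.isInvertible_transition
    (S.mem_nbhd_self q)).contDiffAt_map_inverse.contMDiffAt (S.contMDiffAt_transition q)

section Sections

variable {F H N : Type} [NormedAddCommGroup F] [NormedSpace ℝ F] [TopologicalSpace H]
  {I : ModelWithCorners ℝ F H} [TopologicalSpace N] [ChartedSpace H N]

/-- A vector field along a smooth map is smooth if its components in the frame are. -/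
theorem contMDiffAt_mk {p : N → S.carrier} {v : N → E} {z : N}
    (hp : ContMDiffAt I 𝓘(ℝ, E) ∞ p z) (hv : ContMDiffAt I 𝓘(ℝ, E) ∞ v z) :
    ContMDiffAt I 𝓘(ℝ, E).tangent ∞
      (fun z => (⟨p z, v z⟩ : TangentBundle 𝓘(ℝ, E) S.carrier)) z := by
  rw [Bundle.contMDiffAt_totalSpace]
  refine ⟨hp, ?_⟩
  have h1 : ContMDiffAt I 𝓘(ℝ, E →L[ℝ] E) ∞ (fun z' => S.transition (p z) (p z')) z :=
    (S.contMDiffAt_transition (p z)).comp z hp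
  refine (h1.clm_apply hv).congr_of_eventuallyEq ?_
  filter_upwards [hp.continuousAt.eventually (S.eventually_mem_nbhd (p z))] with z' hz'
  exact S.trivializationAt_snd hz' _

theorem contMDiff_mk {p : N → S.carrier} {v : N → E}
    (hp : ContMDiff I 𝓘(ℝ, E) ∞ p) (hv : ContMDiff I 𝓘(ℝ, E) ∞ v) :
    ContMDiff I 𝓘(ℝ, E).tangent ∞
      (fun z => (⟨p z, v z⟩ : TangentBundle 𝓘(ℝ, E) S.carrier)) :=
  fun z => S.contMDiffAt_mk (hp z) (hv z)

end Sections

/-- A differentiable vector field has differentiable components in the frame. -/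
theorem mdifferentiableAt_components [CompleteSpace E] {v : S.carrier → E} {q : S.carrier}
    (h : MDifferentiableAt 𝓘(ℝ, E) 𝓘(ℝ, E).tangent
      (fun z => (⟨z, v z⟩ : TangentBundle 𝓘(ℝ, E) S.carrier)) q) :
    MDifferentiableAt 𝓘(ℝ, E) 𝓘(ℝ, E) v q := by
  rw [mdifferentiableAt_totalSpace] at h
  obtain ⟨-, h⟩ := h
  have h1 := (S.contMDiffAt_inverse_transition q).mdifferentiableAt (by simp)
  refine (h1.clm_apply h).congr_of_eventuallyEq ?_
  filter_upwards [S.eventually_mem_nbhd q] with z' hz'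
  have h5 : (trivializationAt E (TangentSpace 𝓘(ℝ, E)) q
      (⟨z', v z'⟩ : TangentBundle 𝓘(ℝ, E) S.carrier)).2 = S.transition q z' (v z') :=
    S.trivializationAt_snd hz' _
  change v z' = (S.transition q z').inverse (trivializationAt E (TangentSpace 𝓘(ℝ, E)) q
      (⟨z', v z'⟩ : TangentBundle 𝓘(ℝ, E) S.carrier)).2
  rw [h5]
  exact ((S.isInvertible_transition hz').inverse_apply_eq.2 rfl).symm

end FramedSubmanifold

/-! ### Lie brackets of the frame fields -/

namespace FramedSubmanifold

variable {E W : Type} [NormedAddCommGroup E] [NormedSpace ℝ E]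
  [NormedAddCommGroup W] [NormedSpace ℝ W] (S : FramedSubmanifold E W)

/-- Differentiating the inclusion read in a chart: a coordinate vector pushed to the manifold and
then to `W` is the corresponding partial derivative of the parametrization. -/
theorem frame_mfderiv_symm (q : S.carrier) (s : E) (v : E) :
    S.frame (S.param q s) (mfderiv 𝓘(ℝ, E) 𝓘(ℝ, E) (extChartAt 𝓘(ℝ, E) q).symm s v) =
      fderiv ℝ (S.param q) s v := by
  have h1 : MDifferentiableAt 𝓘(ℝ, E) 𝓘(ℝ, E) (extChartAt 𝓘(ℝ, E) q).symm s := by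
    have := (contMDiffOn_extChartAt_symm (I := 𝓘(ℝ, E)) (n := ∞) q)
    rw [S.extChartAt_target, contMDiffOn_univ] at this
    exact this.mdifferentiable (by simp) s
  have h2 := (S.hasMFDerivAt_coe ((extChartAt 𝓘(ℝ, E) q).symm s)).comp s h1.hasMFDerivAt
  have h3 : HasMFDerivAt 𝓘(ℝ, E) 𝓘(ℝ, W) (S.param q) s (fderiv ℝ (S.param q) s) :=
    (((S.contDiff_param q).differentiable (by simp)).differentiableAt).hasFDerivAt.hasMFDerivAt
  exact DFunLike.congr_fun (hasMFDerivAt_unique h2 h3) v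

theorem fderiv_coord_comp_param (q : S.carrier) (s : E) :
    (fderiv ℝ (S.coord q) (S.param q s)).comp (fderiv ℝ (S.param q) s) = .id ℝ E := by
  have h := ((S.coord_differentiableAt q (S.param_mem_nbhd q s)).hasFDerivAt).comp s
    ((S.contDiff_param q).differentiable (by simp) s).hasFDerivAt
  have h3 : (S.coord q ∘ S.param q) = id := funext (S.coord_param q)
  rw [h3] at h
  exact h.unique (hasFDerivAt_id s)

/-- The derivative of the inverse of the chart centred at `q` is inverse to `transition q`. -/
theorem exists_equiv_transition (q : S.carrier) (s : E) :
    ∃ e : E ≃L[ℝ] E, (e : E →L[ℝ] E) = S.transition q (S.param q s) ∧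
      (mfderiv 𝓘(ℝ, E) 𝓘(ℝ, E) (extChartAt 𝓘(ℝ, E) q).symm s : E →L[ℝ] E) =
        (e.symm : E →L[ℝ] E) := by
  set p : S.carrier := (extChartAt 𝓘(ℝ, E) q).symm s with hp
  have hpn : (p : W) ∈ S.nbhd q := S.param_mem_nbhd q s
  obtain ⟨e, he⟩ := S.isInvertible_transition hpn
  refine ⟨e, he, ?_⟩
  ext w
  have h : S.transition q p
      (mfderiv 𝓘(ℝ, E) 𝓘(ℝ, E) (extChartAt 𝓘(ℝ, E) q).symm s w) = w := by
    refine (congrArg (fderiv ℝ (S.coord q) (S.param q s)) (S.frame_mfderiv_symm q s w)).trans ?_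
    exact DFunLike.congr_fun (S.fderiv_coord_comp_param q s) w
  rw [← he] at h
  exact (e.symm_apply_eq.2 h.symm).symm

/-- The frame field of constant components `v`, read in the chart centred at `q`. -/
theorem mfderiv_symm_inverse (q : S.carrier) (s : E) (v : E) :
    (mfderiv 𝓘(ℝ, E) 𝓘(ℝ, E) (extChartAt 𝓘(ℝ, E) q).symm s).inverse v =
      S.transition q (S.param q s) v := by
  obtain ⟨e, he, he'⟩ := S.exists_equiv_transition q s
  refine (congrArg (fun T : E →L[ℝ] E => T.inverse v) he').trans ?_
  rw [← he]
  simp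

/-- The chart components of the frame vector `S.frame p v` are `S.transition q p v`. -/
theorem fderiv_param_transition (q : S.carrier) (s : E) (v : E) :
    fderiv ℝ (S.param q) s (S.transition q (S.param q s) v) = S.frame (S.param q s) v := by
  obtain ⟨e, he, he'⟩ := S.exists_equiv_transition q s
  rw [← S.frame_mfderiv_symm]
  refine congrArg (S.frame (S.param q s)) ?_
  refine (DFunLike.congr_fun he' _).trans ?_
  rw [← he]
  exact e.symm_apply_apply v

/-- The vector field with constant components `v` in the frame. -/
def frameField (v : E) (p : S.carrier) : TangentSpace 𝓘(ℝ, E) p := v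

/-- If the ambient vector fields `x ↦ S.frame x v` bracket on the submanifold with structure
constants `c`, then so do the frame fields, for Mathlib's Lie bracket on the manifold. In the chart
centred at `q` the relation `Dψ(s) T(s) u = F(ψ(s)) u` is differentiated at `s = 0`; the second
derivatives of the parametrization `ψ` cancel by symmetry. -/
theorem mlieBracket_frameField [CompleteSpace E] {c : E → E → E}
    (hc : ∀ q : S.carrier, ∀ v w, fderiv ℝ (fun x => S.frame x w) q (S.frame q v) -
      fderiv ℝ (fun x => S.frame x v) q (S.frame q w) = S.frame q (c v w))
    (v w : E) (q : S.carrier) :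
    VectorField.mlieBracket 𝓘(ℝ, E) (S.frameField v) (S.frameField w) q = S.frameField (c v w) q := by
  rw [← VectorField.mlieBracketWithin_univ, VectorField.mlieBracketWithin_apply]
  -- the derivative of the chart at its centre is the identity
  have h0 : (mfderiv 𝓘(ℝ, E) 𝓘(ℝ, E) (extChartAt 𝓘(ℝ, E) q) q : E →L[ℝ] E) = .id ℝ E := by
    have h1 := ((S.coord_differentiableAt q (S.mem_nbhd_self q)).hasFDerivAt.hasMFDerivAt).comp q
      (S.hasMFDerivAt_coe q)
    exact h1.mfderiv.trans (S.transition_self q)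
  have h1 : ∀ u : E, (mfderiv 𝓘(ℝ, E) 𝓘(ℝ, E) (extChartAt 𝓘(ℝ, E) q) q).inverse u = u := by
    intro u
    have := congrArg (fun T : E →L[ℝ] E => T.inverse u) h0
    refine this.trans ?_
    simp
  refine (h1 _).trans ?_
  have hpull : ∀ u : E, VectorField.mpullbackWithin 𝓘(ℝ, E) 𝓘(ℝ, E) (extChartAt 𝓘(ℝ, E) q).symm
      (S.frameField u) (range 𝓘(ℝ, E)) =
      fun s : E => S.transition q (S.param q s) u := by
    intro u
    ext s
    rw [modelWithCornersSelf_coe, range_id, VectorField.mpullbackWithin_univ,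
      VectorField.mpullback_apply]
    exact S.mfderiv_symm_inverse q s u
  rw [hpull v, hpull w, preimage_univ, univ_inter, modelWithCornersSelf_coe, range_id,
    VectorField.lieBracketWithin_univ, extChartAt_apply, coord_self]
  -- differentiate `Dψ(s) (T(s) u) = F(ψ s) u`
  set P := S.param q
  have hP : ContDiff ℝ ∞ P := S.contDiff_param q
  have hP1 : HasFDerivAt P (S.frame q) 0 := S.hasFDerivAt_param q
  have hP0 : P 0 = q := S.param_zero q
  have hT : ∀ u : E, DifferentiableAt ℝ (fun s => S.transition q (P s) u) 0 := by
    intro u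
    have h2 : ContDiffAt ℝ ∞ (fun s => S.transition q (P s)) 0 :=
      ((S.contDiffOn_transition q).contDiffAt
        ((S.isOpen_nbhd q).mem_nhds (S.param_mem_nbhd q 0))).comp (0 : E) hP.contDiffAt
    exact (h2.differentiableAt (by simp)).clm_apply (differentiableAt_const u)
  have hrel : ∀ u : E, (fun s => fderiv ℝ P s (S.transition q (P s) u)) =
      fun s => S.frame (P s) u :=
    fun u => funext fun s => S.fderiv_param_transition q s u
  have hPd : DifferentiableAt ℝ (fderiv ℝ P) 0 :=
    (hP.fderiv_right (m := ∞) (by simp)).differentiable (by simp) 0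
  have hder : ∀ u z : E, fderiv ℝ (fderiv ℝ P) 0 z u +
      S.frame q (fderiv ℝ (fun s => S.transition q (P s) u) 0 z) =
      fderiv ℝ (fun x => S.frame x u) q (S.frame q z) := by
    intro u z
    have h5 := hPd.hasFDerivAt.clm_apply (hT u).hasFDerivAt
    rw [hrel u] at h5
    have h6 : HasFDerivAt (fun x => S.frame x u) (fderiv ℝ (fun x => S.frame x u) q) (P 0) := by
      rw [hP0]
      exact ((S.contDiff_frame.clm_apply contDiff_const).differentiable
        (by simp) _).hasFDerivAt
    have h7 := DFunLike.congr_fun (h5.unique (h6.comp 0 hP1)) z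
    simp only [ContinuousLinearMap.comp_apply, _root_.add_apply,
      ContinuousLinearMap.flip_apply] at h7
    rw [hP1.fderiv, hP0, S.transition_self] at h7
    rw [← h7, add_comm]
    rfl
  have hsymm : ∀ u z : E, fderiv ℝ (fderiv ℝ P) 0 z u = fderiv ℝ (fderiv ℝ P) 0 u z := by
    intro u z
    exact ((hP.of_le (m := 2) (WithTop.coe_le_coe.2 le_top)).contDiffAt.isSymmSndFDerivAt (by simp)).eq z u
  have hT0 : ∀ u : E, S.transition q (P 0) u = u := by
    intro u
    rw [hP0, S.transition_self]
    rfl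
  apply S.injective_frame q
  change S.frame q _ = S.frame q (c v w)
  rw [VectorField.lieBracket, hT0, hT0, ← hc q v w, ← hder w v, ← hder v w, hsymm w v, map_sub]
  abel

end FramedSubmanifold

/-! ### The metric and the connection attached to the frame -/

namespace FramedSubmanifold

variable {E W : Type} [NormedAddCommGroup E] [InnerProductSpace ℝ E] [FiniteDimensional ℝ E]
  [NormedAddCommGroup W] [NormedSpace ℝ W] (S : FramedSubmanifold E W)

theorem trivializationAt_symm {q p : S.carrier} (hp : (p : W) ∈ S.nbhd q) (v : E) :
    ((trivializationAt E (TangentSpace 𝓘(ℝ, E)) q).symm p v : E) =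
      (S.transition q p).inverse v := by
  have : CompleteSpace E := FiniteDimensional.complete ℝ E
  have hb : p ∈ (trivializationAt E (TangentSpace 𝓘(ℝ, E)) q).baseSet := hp
  set u : E := (trivializationAt E (TangentSpace 𝓘(ℝ, E)) q).symm p v with hu
  have h := (trivializationAt E (TangentSpace 𝓘(ℝ, E)) q).apply_mk_symm hb v
  have h2 : S.transition q p u = v := by
    rw [← S.trivializationAt_snd hp, hu]
    exact congrArg Prod.snd h
  exact ((S.isInvertible_transition hp).inverse_apply_eq.2 h2.symm).symm

variable (E) in
/-- The inner product as a continuous bilinear map. -/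
noncomputable def innerCLM : E →L[ℝ] E →L[ℝ] ℝ :=
  (isBoundedBilinearMap_inner (𝕜 := ℝ) (E := E)).toContinuousLinearMap

/-- The Riemannian metric for which the frame is orthonormal, for the inner product of `E`. -/
noncomputable def metric : Bundle.ContMDiffRiemannianMetric 𝓘(ℝ, E) ∞ E
    (fun x : S.carrier => TangentSpace 𝓘(ℝ, E) x) where
  inner _ := innerCLM E
  symm _ v w := real_inner_comm (F := E) w v
  pos _ v hv := real_inner_self_pos (F := E).2 hv
  isVonNBounded q := by
    change Bornology.IsVonNBounded ℝ {v : E | inner ℝ v v < 1}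
    rw [NormedSpace.isVonNBounded_iff]
    refine (Metric.isBounded_ball (x := (0 : E)) (r := 1)).subset ?_
    intro (v : E) hv
    rw [mem_ofPred_eq, real_inner_self_eq_norm_sq] at hv
    rw [mem_ball_zero_iff]
    nlinarith [norm_nonneg v]
  contMDiff := by
    have : CompleteSpace E := FiniteDimensional.complete ℝ E
    intro q
    rw [contMDiffAt_hom_bundle]
    refine ⟨contMDiff_id.contMDiffAt, ?_⟩
    have h2 := S.contMDiffAt_inverse_transition q
    -- in the chart at `q` the metric is `(v, w) ↦ ⟨T⁻¹ v, T⁻¹ w⟩`, with `T` the transition map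
    have h4 : ContMDiffAt 𝓘(ℝ, E) 𝓘(ℝ, E →L[ℝ] E →L[ℝ] ℝ) ∞
      (fun p : S.carrier => (((ContinuousLinearMap.compL ℝ E E ℝ).flip
        ((S.transition q p).inverse)).comp
          ((innerCLM E).comp ((S.transition q p).inverse)))) q :=
      (contMDiffAt_const.clm_apply h2).clm_comp (contMDiffAt_const.clm_comp h2)
    refine h4.congr_of_eventuallyEq ?_
    filter_upwards [S.eventually_mem_nbhd q] with p hp
    ext v w
    have hb : p ∈ (trivializationAt E (TangentSpace 𝓘(ℝ, E)) q).baseSet := hp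
    refine (inCoordinates_apply_eq₂ (E₁ := fun x : S.carrier => TangentSpace 𝓘(ℝ, E) x)
      (E₂ := fun x : S.carrier => TangentSpace 𝓘(ℝ, E) x)
      (E₃ := fun _ : S.carrier => ℝ) hb hb (mem_univ _)).trans ?_
    have hl : ∀ r : ℝ, (trivializationAt ℝ (fun _ : S.carrier => ℝ) q).linearMapAt ℝ p r = r :=
      fun r => DFunLike.congr_fun (Bundle.Trivial.linearMapAt_trivialization ℝ _ _ p) r
    refine (hl _).trans ?_
    exact congrArg₂ (fun a b : E => innerCLM E a b) (S.trivializationAt_symm hp v)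
      (S.trivializationAt_symm hp w)

/-- The derivative of the components of a vector field. -/
noncomputable def componentDeriv (f : S.carrier → E) (q : S.carrier) : E →L[ℝ] E :=
  mvfderiv 𝓘(ℝ, E) f q

/-- The connection with constant coefficients `Γ` in the frame: on components,
`∇_v σ = dσ(v) + Γ(v, σ)`. -/
noncomputable def connection (Γ : E →L[ℝ] E →L[ℝ] E) : CovariantDerivative 𝓘(ℝ, E) E
    (fun x : S.carrier => TangentSpace 𝓘(ℝ, E) x) where
  toFun σ q := S.componentDeriv σ q + Γ.flip (σ q)
  isCovariantDerivativeOnUniv :=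
    { add := by
        intro σ σ' q hσ hσ' _
        have : CompleteSpace E := FiniteDimensional.complete ℝ E
        have h1 : MDifferentiableAt 𝓘(ℝ, E) 𝓘(ℝ, E) (fun p => (σ p : E)) q :=
          S.mdifferentiableAt_components hσ
        have h2 : MDifferentiableAt 𝓘(ℝ, E) 𝓘(ℝ, E) (fun p => (σ' p : E)) q :=
          S.mdifferentiableAt_components hσ'
        have h3 : S.componentDeriv (fun p => (σ p : E) + (σ' p : E)) q =
            S.componentDeriv σ q + S.componentDeriv σ' q := mvfderiv_add h1 h2
        have h4 : Γ.flip (σ q + σ' q : E) = Γ.flip (σ q) + Γ.flip (σ' q) := map_add _ _ _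
        refine (congrArg₂ (· + ·) h3 h4).trans ?_
        exact add_add_add_comm _ _ _ _
      leibniz := by
        intro σ g q hσ hg _
        have : CompleteSpace E := FiniteDimensional.complete ℝ E
        have h1 : MDifferentiableAt 𝓘(ℝ, E) 𝓘(ℝ, E) (fun p => (σ p : E)) q :=
          S.mdifferentiableAt_components hσ
        let dg : E →L[ℝ] ℝ := mvfderiv 𝓘(ℝ, E) g q
        let s : E := σ q
        have h3 : S.componentDeriv (fun p => g p • (σ p : E)) q = g q • S.componentDeriv σ q +
            dg.smulRight s :=
          mvfderiv_smul hg h1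
        have h4 : Γ.flip (g q • σ q : E) = g q • Γ.flip (σ q) := map_smul _ _ _
        refine (congrArg₂ (· + ·) h3 h4).trans ?_
        have h5 : g q • S.componentDeriv σ q + dg.smulRight s + g q • Γ.flip s =
            g q • (S.componentDeriv σ q + Γ.flip s) + dg.smulRight s := by
          rw [smul_add]
          exact add_right_comm _ _ _
        exact h5 }

theorem connection_apply (Γ : E →L[ℝ] E →L[ℝ] E) (σ : (q : S.carrier) → TangentSpace 𝓘(ℝ, E) q)
    (q : S.carrier) (v : E) :
    (S.connection Γ σ q v : E) = S.componentDeriv σ q v + Γ v (σ q) := rfl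

theorem connection_frameField (Γ : E →L[ℝ] E →L[ℝ] E) (w : E) (q : S.carrier) :
    (S.connection Γ (S.frameField w) q : E →L[ℝ] E) = Γ.flip w := by
  ext v
  refine (S.connection_apply Γ _ q v).trans ?_
  have : S.componentDeriv (S.frameField w) q = 0 :=
    mvfderiv_const (I := 𝓘(ℝ, E)) w
  rw [this]
  exact zero_add _

omit [FiniteDimensional ℝ E] in
theorem contMDiff_frameField (w : E) : ContMDiff 𝓘(ℝ, E) 𝓘(ℝ, E).tangent ∞
    (fun q => (⟨q, S.frameField w q⟩ : TangentBundle 𝓘(ℝ, E) S.carrier)) :=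
  S.contMDiff_mk contMDiff_id contMDiff_const

end FramedSubmanifold

/-! ### The compact Riemannian manifold and its frame fields -/

namespace FramedSubmanifold

variable {E W : Type} [NormedAddCommGroup E] [InnerProductSpace ℝ E] [FiniteDimensional ℝ E]
  [NormedAddCommGroup W] [NormedSpace ℝ W] (S : FramedSubmanifold E W)

omit [FiniteDimensional ℝ E] in
theorem mvfderiv_inner {f g : S.carrier → E} {q : S.carrier}
    (hf : MDifferentiableAt 𝓘(ℝ, E) 𝓘(ℝ, E) f q) (hg : MDifferentiableAt 𝓘(ℝ, E) 𝓘(ℝ, E) g q)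
    (v : E) :
    mvfderiv 𝓘(ℝ, E) (fun p => (inner ℝ (f p) (g p) : ℝ)) q v =
      inner ℝ (f q) (S.componentDeriv g q v) + inner ℝ (S.componentDeriv f q v) (g q) := by
  have hB := (isBoundedBilinearMap_inner (𝕜 := ℝ) (E := E)).hasFDerivAt (f q, g q)
  have hfg : HasMFDerivAt 𝓘(ℝ, E) 𝓘(ℝ, E × E) (fun p => (f p, g p)) q
      ((S.componentDeriv f q).prod (S.componentDeriv g q)) :=
    ⟨hf.continuousAt.prodMk hg.continuousAt, hf.hasMFDerivAt.2.prodMk hg.hasMFDerivAt.2⟩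
  have h3 := HasMFDerivAt.comp (I' := 𝓘(ℝ, E × E)) (f := fun p => (f p, g p)) q hB.hasMFDerivAt hfg
  exact DFunLike.congr_fun h3.mfderiv v

variable [CompactSpace S.carrier]

/-- A compact framed submanifold, with the metric making the frame orthonormal. -/
noncomputable abbrev toRiemannian : CompactRiemannianManifold where
  E := E
  M := S.carrier
  g := S.metric

/-- Constant coefficients that are skew and compensate the structure constants of the frame define
the Levi-Civita connection. -/
theorem isLeviCivita {Γ : E →L[ℝ] E →L[ℝ] E} {c : E → E → E}
    (hc : ∀ q : S.carrier, ∀ v w, fderiv ℝ (fun x => S.frame x w) q (S.frame q v) -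
      fderiv ℝ (fun x => S.frame x v) q (S.frame q w) = S.frame q (c v w))
    (hΓc : ∀ v w, Γ v w - Γ w v = c v w)
    (hΓ : ∀ v u w, inner ℝ (Γ v u) w + inner ℝ u (Γ v w) = 0) :
    CompactRiemannianManifold.IsLeviCivita (R := S.toRiemannian) (S.connection Γ) := by
  have : CompleteSpace E := FiniteDimensional.complete ℝ E
  constructor
  · ext q v w
    have hv := (S.contMDiff_frameField v).mdifferentiable (by simp) q
    have hw := (S.contMDiff_frameField w).mdifferentiable (by simp) q
    refine (CovariantDerivative.torsion_apply (S.connection Γ) hv hw).trans ?_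
    have h1 : (S.connection Γ (S.frameField w) q (S.frameField v q) : E) = Γ v w :=
      DFunLike.congr_fun (S.connection_frameField Γ w q) v
    have h2 : (S.connection Γ (S.frameField v) q (S.frameField w q) : E) = Γ w v :=
      DFunLike.congr_fun (S.connection_frameField Γ v q) w
    have h3 := S.mlieBracket_frameField hc v w q
    refine (congrArg₂ (fun a b : E => a - b) (congrArg₂ (fun a b : E => a - b) h1 h2) h3).trans ?_
    exact sub_eq_zero.2 (hΓc v w)
  · intro q v Y Z hY hZ
    have h1 : MDifferentiableAt 𝓘(ℝ, E) 𝓘(ℝ, E) (fun p => (Y p : E)) q :=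
      S.mdifferentiableAt_components hY
    have h2 : MDifferentiableAt 𝓘(ℝ, E) 𝓘(ℝ, E) (fun p => (Z p : E)) q :=
      S.mdifferentiableAt_components hZ
    refine (S.mvfderiv_inner h1 h2 v).trans ?_
    have key : ∀ v y z a b : E, (inner ℝ y b : ℝ) + inner ℝ a z =
        inner ℝ (a + Γ v y) z + inner ℝ y (b + Γ v z) := by
      intro v y z a b
      rw [inner_add_left, inner_add_right]
      linarith [hΓ v y z]
    exact key v (Y q) (Z q) (S.componentDeriv Y q v) (S.componentDeriv Z q v)

/-- The vector field with constant components `v`, as a smooth section. -/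
noncomputable def frameSection : E →ₗ[ℝ] S.toRiemannian.VF where
  toFun v := ⟨S.frameField v, S.contMDiff_frameField v⟩
  map_add' _ _ := rfl
  map_smul' _ _ := rfl

theorem divergence_frameSection (Γ : E →L[ℝ] E →L[ℝ] E) (v : E) (q : S.carrier) :
    CompactRiemannianManifold.divergence (R := S.toRiemannian) (S.connection Γ)
      (S.frameSection v) q = LinearMap.trace ℝ E (Γ.flip v : E →L[ℝ] E) :=
  congrArg (fun T : E →L[ℝ] E => LinearMap.trace ℝ E (T : E →ₗ[ℝ] E))
    (S.connection_frameField Γ v q)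

theorem localRep_frameSection (v : E) (q : S.carrier) :
    CompactRiemannianManifold.localRep (R := S.toRiemannian) (S.frameSection v) q =
      fun s => S.transition q (S.param q s) v := by
  ext s
  exact S.trivializationAt_snd (S.param_mem_nbhd q s) v

/-- The frame fields depend continuously on their components in every `C^k` topology. In a chart
the derivatives of a frame field are jointly continuous in the components and the point, and
currying turns this into continuity for uniform convergence on compact sets. -/
theorem continuous_frameSection (k : ℕ∞) :
    @Continuous E S.toRiemannian.VF _ (CompactRiemannianManifold.ckTopology S.toRiemannian k)
      S.frameSection := by
  simp only [continuous_iInf_rng, continuous_induced_rng]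
  intro q j _
  have hB : ContDiff ℝ ∞ (fun s => S.transition q (S.param q s)) := by
    rw [← contDiffOn_univ]
    exact (S.contDiffOn_transition q).comp (S.contDiff_param q).contDiffOn
      (fun s _ => S.param_mem_nbhd q s)
  set B := fun s => S.transition q (S.param q s) with hBdef
  have h1 : ∀ v s, iteratedFDeriv ℝ j (CompactRiemannianManifold.localRep (R := S.toRiemannian)
      (S.frameSection v) q) s = (ContinuousLinearMap.apply ℝ E v).compContinuousMultilinearMap
        (iteratedFDeriv ℝ j B s) := by
    intro v s
    rw [localRep_frameSection]
    exact ContinuousLinearMap.iteratedFDeriv_comp_left (ContinuousLinearMap.apply ℝ E v)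
      hB.contDiffAt (by exact_mod_cast le_top)
  have h2 : Continuous (fun z : E × E => iteratedFDeriv ℝ j
      (CompactRiemannianManifold.localRep (R := S.toRiemannian) (S.frameSection z.1) q) z.2) := by
    have h3 : Continuous (fun s => iteratedFDeriv ℝ j B s) :=
      hB.continuous_iteratedFDeriv (by exact_mod_cast le_top)
    simp only [h1]
    have h4 : Continuous (fun z : E × E =>
        (ContinuousLinearMap.compContinuousMultilinearMapL ℝ (fun _ : Fin j => E) (E →L[ℝ] E) E
          (ContinuousLinearMap.apply ℝ E z.1)) (iteratedFDeriv ℝ j B z.2)) := by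
      exact ((ContinuousLinearMap.continuous _).comp
        ((ContinuousLinearMap.continuous _).comp continuous_fst)).clm_apply (h3.comp continuous_snd)
    exact h4
  have h5 := (ContinuousMap.curry ⟨_, h2⟩).continuous
  have h6 := (ContinuousMap.isUniformEmbedding_toUniformOnFunIsCompact
    (α := E) (β := E [×j]→L[ℝ] E)).uniformContinuous.continuous.comp h5
  have h7 : {K : Set E | IsCompact K ∧ K ⊆ (extChartAt 𝓘(ℝ, E) q).target} =
      {K : Set E | IsCompact K} := by
    rw [S.extChartAt_target]
    simp
  -- generalized over the family of sets, on which the type of the map depends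
  have h8 : ∀ 𝔖 : Set (Set E), 𝔖 = {K : Set E | IsCompact K} →
    Continuous (fun v => UniformOnFun.ofFun 𝔖 (iteratedFDeriv ℝ j
      (CompactRiemannianManifold.localRep (R := S.toRiemannian) (S.frameSection v) q))) := by
    rintro _ rfl
    exact h6
  exact h8 _ h7

/-- Already the `C⁰` topology makes point evaluations continuous, hence so does every finer one. -/
theorem continuous_eval (k : ℕ∞) (q : S.carrier) :
    @Continuous S.toRiemannian.VF E (CompactRiemannianManifold.ckTopology S.toRiemannian k) _
      (fun u => (u q : E)) := by
  let _ : TopologicalSpace S.toRiemannian.VF :=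
    CompactRiemannianManifold.ckTopology S.toRiemannian k
  let 𝔖 := {K : Set E | IsCompact K ∧ K ⊆ (extChartAt 𝓘(ℝ, E) q).target}
  have h1 : Continuous (fun u : S.toRiemannian.VF => UniformOnFun.ofFun 𝔖
      (iteratedFDeriv ℝ 0 (CompactRiemannianManifold.localRep u q))) := by
    rw [continuous_iff_le_induced]
    exact (iInf_le _ q).trans ((iInf_le _ 0).trans (iInf_le _ (by simp)))
  have h2 := (UniformOnFun.uniformContinuous_eval_of_mem (E [×0]→L[ℝ] E) 𝔖
    (x := (0 : E)) (s := {0}) rfl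
    ⟨isCompact_singleton, by rw [S.extChartAt_target]; exact subset_univ _⟩).continuous.comp h1
  have h3 : Continuous (fun T : E [×0]→L[ℝ] E => T 0) := by fun_prop
  refine (h3.comp h2).congr ?_
  intro u
  change (trivializationAt E (TangentSpace 𝓘(ℝ, E)) q
      ⟨(extChartAt 𝓘(ℝ, E) q).symm 0, u ((extChartAt 𝓘(ℝ, E) q).symm 0)⟩).2 = (u q : E)
  have h4 : (extChartAt 𝓘(ℝ, E) q).symm 0 = q := Subtype.ext (S.param_zero q)
  rw [h4]
  refine (S.trivializationAt_snd (S.mem_nbhd_self q) (u q)).trans ?_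
  rw [S.transition_self]
  rfl

end FramedSubmanifold

/-! ### Euler flows with constant components in the frame -/

namespace FramedSubmanifold

variable {E W : Type} [NormedAddCommGroup E] [InnerProductSpace ℝ E] [FiniteDimensional ℝ E]
  [NormedAddCommGroup W] [NormedSpace ℝ W] (S : FramedSubmanifold E W) [CompactSpace S.carrier]

/-- Solutions of the ordinary differential equation `u' + Γ(u, u) = 0` in `E` are Euler solutions with
zero pressure, provided they stay among the divergence-free frame fields. -/
theorem isEulerSolution {Γ : E →L[ℝ] E →L[ℝ] E} {u u' : ℝ → E} (hu : ContDiff ℝ ∞ u)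
    (hu' : ∀ t, HasDerivAt u (u' t) t)
    (htr : ∀ t, LinearMap.trace ℝ E (Γ.flip (u t) : E →L[ℝ] E) = 0)
    (heq : ∀ t, u' t + Γ (u t) (u t) = 0) :
    CompactRiemannianManifold.IsEulerSolution (R := S.toRiemannian) (S.connection Γ)
      (fun t => (S.frameSection (u t) : S.toRiemannian.VF)) where
  smooth := S.contMDiff_mk contMDiff_snd (hu.contMDiff.comp contMDiff_fst)
  div_eq_zero t q := (S.divergence_frameSection Γ (u t) q).trans (htr t)
  momentum := by
    refine ⟨fun _ _ => 0, fun _ => S.frameField 0, contMDiff_const, ?_, ?_⟩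
    · intro t q v
      have h : mvfderiv 𝓘(ℝ, E) (fun _ : S.carrier => (0 : ℝ)) q = 0 := mvfderiv_const 0
      refine Eq.trans ?_ (DFunLike.congr_fun h v).symm
      exact inner_zero_left (𝕜 := ℝ) (E := E) v
    · intro t q
      refine ⟨u' t, hu' t, ?_⟩
      have h : (S.connection Γ (S.frameField (u t)) q (u t) : E) = Γ (u t) (u t) :=
        DFunLike.congr_fun (S.connection_frameField Γ (u t) q) (u t)
      refine (congrArg (fun z : E => u' t + z) h).trans ((heq t).trans ?_)
      exact (neg_zero (G := E)).symm

variable {m : ℕ} {ι : (Fin m → ℝ) →ₗ[ℝ] E}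

/-- The components of a frame field, for the space of the frame fields with components in the range
of the injective linear map `ι`. -/
noncomputable def fieldEquiv [Nonempty S.carrier] (hι : Function.Injective ι) :
    LinearMap.range (S.frameSection ∘ₗ ι) ≃ₗ[ℝ] (Fin m → ℝ) :=
  (LinearEquiv.ofInjective (S.frameSection ∘ₗ ι) (by
    intro y z hyz
    apply hι
    exact congrArg (fun u : S.toRiemannian.VF => (u (Classical.arbitrary S.carrier) : E))
      hyz)).symm

theorem isHomeomorph_fieldEquiv [Nonempty S.carrier] (hι : Function.Injective ι) (k : ℕ∞) :
    @IsHomeomorph (LinearMap.range (S.frameSection ∘ₗ ι)) (Fin m → ℝ)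
      (TopologicalSpace.induced Subtype.val
        (CompactRiemannianManifold.ckTopology S.toRiemannian k)) _ (S.fieldEquiv hι) := by
  let _ : TopologicalSpace S.toRiemannian.VF :=
    CompactRiemannianManifold.ckTopology S.toRiemannian k
  let q : S.carrier := Classical.arbitrary _
  obtain ⟨g, hg⟩ := ι.exists_leftInverse_of_injective (LinearMap.ker_eq_bot.2 hι)
  have hsymm : ∀ y, ((S.fieldEquiv hι).symm y : S.toRiemannian.VF) = S.frameSection (ι y) :=
    fun y => rfl
  refine Homeomorph.isHomeomorph
    { toEquiv := (S.fieldEquiv hι).toEquiv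
      continuous_toFun := ?_
      continuous_invFun := ?_ }
  · have h1 : Continuous (fun u : LinearMap.range (S.frameSection ∘ₗ ι) =>
        g ((u : S.toRiemannian.VF) q : E)) :=
      (LinearMap.continuous_of_finiteDimensional g).comp
        ((S.continuous_eval k q).comp continuous_subtype_val)
    refine h1.congr ?_
    intro u
    obtain ⟨y, rfl⟩ := (S.fieldEquiv hι).symm.surjective u
    rw [hsymm]
    refine (DFunLike.congr_fun hg y).trans ?_
    exact ((S.fieldEquiv hι).apply_symm_apply y).symm
  · refine Continuous.subtype_mk (f := fun y => S.frameSection (ι y)) ?_ _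
    exact (S.continuous_frameSection k).comp (LinearMap.continuous_of_finiteDimensional ι)

/-- If `f : N → ℝ^m` is an embedding conjugating the flow of `X` to a system `y' = B(y)` whose
solutions, seen as frame fields through `ι`, satisfy the Euler equations, then the dynamics of `X`
embeds in the Euler equations. -/
theorem embedsInEuler [Nonempty S.carrier] {d : ℕ} (hS : S.toRiemannian.IsSOTorus d)
    {Γ : E →L[ℝ] E →L[ℝ] E} {c : E → E → E}
    (hc : ∀ q : S.carrier, ∀ v w, fderiv ℝ (fun x => S.frame x w) q (S.frame q v) -
      fderiv ℝ (fun x => S.frame x v) q (S.frame q w) = S.frame q (c v w))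
    (hΓc : ∀ v w, Γ v w - Γ w v = c v w)
    (hΓ : ∀ v u w, inner ℝ (Γ v u) w + inner ℝ u (Γ v w) = 0)
    (hι : Function.Injective ι)
    (htr : ∀ y, LinearMap.trace ℝ E (Γ.flip (ι y) : E →L[ℝ] E) = 0)
    {B : (Fin m → ℝ) → (Fin m → ℝ)} (hB : ∀ y, ι (B y) + Γ (ι y) (ι y) = 0)
    {F H N : Type} [NormedAddCommGroup F] [NormedSpace ℝ F] [TopologicalSpace H]
    {I : ModelWithCorners ℝ F H} [TopologicalSpace N] [ChartedSpace H N]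
    {X : (x : N) → TangentSpace I x} {φ : ℝ → N → N} (hφ : IsGlobalFlow X φ)
    {f : N → Fin m → ℝ} (hf : IsSmoothEmbeddingIn I f)
    (hfs : ∀ x, ContDiff ℝ ∞ (fun t => f (φ t x)))
    (hfd : ∀ x t, HasDerivAt (fun t => f (φ t x)) (B (f (φ t x))) t) :
    EmbedsInEuler I X := by
  have hιc : Continuous ι := LinearMap.continuous_of_finiteDimensional ι
  refine ⟨d, S.toRiemannian, S.connection Γ, LinearMap.range (S.frameSection ∘ₗ ι),
    fun x => (S.fieldEquiv hι).symm (f x), φ, hS, S.isLeviCivita hc hΓc hΓ, ?_, ?_, ?_, hφ, ?_⟩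
  · exact LinearMap.finiteDimensional_range _
  · rintro _ ⟨y, rfl⟩ q
    exact (S.divergence_frameSection Γ (ι y) q).trans (htr y)
  · intro k
    refine ⟨m, S.fieldEquiv hι, S.isHomeomorph_fieldEquiv hι k, ?_⟩
    simpa using hf
  · intro x
    refine ⟨?_, by rw [hφ.1 x]⟩
    let ιL : (Fin m → ℝ) →L[ℝ] E := ⟨ι, hιc⟩
    exact S.isEulerSolution (Γ := Γ) (u := fun t => ι (f (φ t x)))
      (u' := fun t => ι (B (f (φ t x)))) (ιL.contDiff.comp (hfs x))
      (fun t => ιL.hasFDerivAt.comp_hasDerivAt t (hfd x t)) (fun t => htr _) (fun t => hB _)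

end FramedSubmanifold

/-! ### The Koszul formula for constant structure constants -/

section Koszul

variable {E : Type} [NormedAddCommGroup E] [InnerProductSpace ℝ E] [FiniteDimensional ℝ E]

theorem trace_eq_zero_of_skew (T : E →ₗ[ℝ] E) (hT : ∀ v, inner ℝ (T v) v = (0 : ℝ)) :
    LinearMap.trace ℝ E T = 0 := by
  rw [LinearMap.trace_eq_sum_inner T (stdOrthonormalBasis ℝ E)]
  refine Finset.sum_eq_zero fun i _ => ?_
  rw [real_inner_comm]
  exact hT _

/-- Koszul formula on a Euclidean space with a skew bracket `c`: there is a unique `Γ` that is skew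
and has torsion `0`, namely `2 Γ(v, w) = c(v, w) - c(v)ᵀ w - c(w)ᵀ v`. In particular
`Γ(v, v) = -c(v)ᵀ v`, and the divergence `tr Γ(·, w)` is `-tr c(w)`. The Jacobi identity plays no
role. -/
theorem exists_koszul (c : E →ₗ[ℝ] E →ₗ[ℝ] E) (hc : ∀ v, c v v = 0) :
    ∃ Γ : E →L[ℝ] E →L[ℝ] E, (∀ v w, Γ v w - Γ w v = c v w) ∧
      (∀ v u w, inner ℝ (Γ v u) w + inner ℝ u (Γ v w) = (0 : ℝ)) ∧
      (∀ v w, inner ℝ (Γ v v) w = (- inner ℝ v (c v w) : ℝ)) ∧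
      ∀ w, LinearMap.trace ℝ E (Γ.flip w : E →L[ℝ] E) = - LinearMap.trace ℝ E (c w) := by
  have hanti : ∀ v w, c w v = - c v w := by
    intro v w
    have h := hc (v + w)
    simp only [map_add, LinearMap.add_apply, hc, zero_add, add_zero] at h
    exact eq_neg_of_add_eq_zero_left (by rw [add_comm] at h; rw [add_comm]; exact h)
  let G : E →ₗ[ℝ] E →ₗ[ℝ] E := LinearMap.mk₂ ℝ
    (fun v w => (1 / 2 : ℝ) • (c v w - LinearMap.adjoint (c v) w - LinearMap.adjoint (c w) v))
    (by intros; simp only [map_add, LinearMap.add_apply]; module)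
    (by intros; simp only [map_smul, LinearMap.smul_apply]; module)
    (by intros; simp only [map_add, LinearMap.add_apply]; module)
    (by intros; simp only [map_smul, LinearMap.smul_apply]; module)
  let Γ : E →L[ℝ] E →L[ℝ] E := LinearMap.toContinuousLinearMap
    ((LinearMap.toContinuousLinearMap : (E →ₗ[ℝ] E) ≃ₗ[ℝ] (E →L[ℝ] E)).toLinearMap ∘ₗ G)
  have hΓ : ∀ v w, Γ v w = (1 / 2 : ℝ) • (c v w - LinearMap.adjoint (c v) w
      - LinearMap.adjoint (c w) v) := fun _ _ => rfl
  have hin : ∀ v w z, inner ℝ (Γ v w) z =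
      (1 / 2 : ℝ) * (inner ℝ (c v w) z - inner ℝ w (c v z) - inner ℝ v (c w z)) := by
    intro v w z
    rw [hΓ, real_inner_smul_left, inner_sub_left, inner_sub_left, LinearMap.adjoint_inner_left,
      LinearMap.adjoint_inner_left]
  have htors : ∀ v w, Γ v w - Γ w v = c v w := by
    intro v w
    rw [hΓ, hΓ, hanti v w]
    module
  have hskew : ∀ v u w, inner ℝ (Γ v u) w + inner ℝ u (Γ v w) = (0 : ℝ) := by
    intro v u w
    rw [real_inner_comm (Γ v w) u, hin, hin, hanti u w, inner_neg_right,
      real_inner_comm (c v w) u, real_inner_comm (c v u) w]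
    ring
  refine ⟨Γ, htors, hskew, ?_, ?_⟩
  · intro v w
    rw [hin, hc, inner_zero_left]
    ring
  · intro w
    have h1 : ((Γ.flip w : E →L[ℝ] E) : E →ₗ[ℝ] E) = (Γ w : E →ₗ[ℝ] E) - c w := by
      ext v
      have := htors v w
      rw [hanti w v] at this
      simp only [ContinuousLinearMap.coe_coe, ContinuousLinearMap.flip_apply, LinearMap.sub_apply]
      rw [sub_eq_iff_eq_add.1 this]
      abel
    rw [h1, map_sub, trace_eq_zero_of_skew, zero_sub]
    intro v
    have := hskew w v v
    rw [real_inner_comm (Γ w v) v] at this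
    simp only [ContinuousLinearMap.coe_coe]
    linarith

end Koszul

/-! ### The Cayley transform -/

section Cayley

variable {A : Type*} [Ring A]

/-- The Cayley transform `(1 + X)(1 - X)⁻¹`; the inverse takes the junk value `0` when `1 - X` is not
invertible. -/
noncomputable def cayley (X : A) : A := (1 + X) * Ring.inverse (1 - X)

/-- The inverse `(R - 1)(R + 1)⁻¹` of the Cayley transform. -/
noncomputable def cayleyInv (R : A) : A := (R - 1) * Ring.inverse (R + 1)

theorem cayley_mul {X : A} (h : IsUnit (1 - X)) : cayley X * (1 - X) = 1 + X := by
  rw [cayley, mul_assoc, Ring.inverse_mul_cancel _ h, mul_one]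

theorem mul_cayley {X : A} (h : IsUnit (1 - X)) : (1 - X) * cayley X = 1 + X := by
  have h1 : (1 - X) * (1 + X) = (1 + X) * (1 - X) := by noncomm_ring
  rw [cayley, ← mul_assoc, h1, mul_assoc, Ring.mul_inverse_cancel _ h, mul_one]

theorem cayleyInv_mul {R : A} (h : IsUnit (R + 1)) : cayleyInv R * (R + 1) = R - 1 := by
  rw [cayleyInv, mul_assoc, Ring.inverse_mul_cancel _ h, mul_one]

theorem mul_cayleyInv {R : A} (h : IsUnit (R + 1)) : (R + 1) * cayleyInv R = R - 1 := by
  have h1 : (R + 1) * (R - 1) = (R - 1) * (R + 1) := by noncomm_ring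
  rw [cayleyInv, ← mul_assoc, h1, mul_assoc, Ring.mul_inverse_cancel _ h, mul_one]

section Star

variable [StarRing A]

theorem star_cayley_mul {X : A} (hX : star X = -X) (h : IsUnit (1 - X)) :
    star (cayley X) * cayley X = 1 := by
  have h1 : IsUnit (1 + X) := by
    have := h.star
    rwa [star_sub, star_one, hX, sub_neg_eq_add] at this
  have h2 : (1 + X) * star (cayley X) = 1 - X := by
    have := congrArg star (cayley_mul h)
    rwa [star_mul, star_sub, star_add, star_one, hX, sub_neg_eq_add, ← sub_eq_add_neg] at this
  apply h1.mul_right_injective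
  change (1 + X) * (star (cayley X) * cayley X) = (1 + X) * 1
  rw [← mul_assoc, h2, mul_cayley h, mul_one]

theorem star_cayleyInv {R : A} (hR : star R * R = 1) (h : IsUnit (R + 1)) :
    star (cayleyInv R) = - cayleyInv R := by
  -- `star R` is inverse to `R`, so that `(star R + 1) * R = 1 + R`
  have h1 : IsUnit (star R + 1) := by
    have := h.star
    rwa [star_add, star_one] at this
  have h2 : (star R + 1) * star (cayleyInv R) = star R - 1 := by
    have := congrArg star (cayleyInv_mul h)
    rwa [star_mul, star_sub, star_add, star_one] at this
  have h3 : star R * ((R + 1) * cayleyInv R) = star R * (R - 1) := by rw [mul_cayleyInv h]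
  apply h1.mul_right_injective
  change (star R + 1) * star (cayleyInv R) = (star R + 1) * (- cayleyInv R)
  rw [h2]
  have h4 : star R * ((R + 1) * cayleyInv R) = (star R * R + star R) * cayleyInv R := by
    noncomm_ring
  have h5 : star R * (R - 1) = star R * R - star R := by noncomm_ring
  rw [h4, h5, hR] at h3
  have h6 : (star R + 1) * (- cayleyInv R) = - ((1 + star R) * cayleyInv R) := by noncomm_ring
  rw [h6, h3]
  abel

end Star

variable [Algebra ℝ A]

variable (A) in
theorem isUnit_two : IsUnit (2 : A) := by
  have : IsUnit (algebraMap ℝ A 2) := (isUnit_iff_ne_zero.2 two_ne_zero).map _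
  rwa [map_ofNat] at this

theorem isUnit_cayley_add_one {X : A} (h : IsUnit (1 - X)) : IsUnit (cayley X + 1) := by
  have h1 : (cayley X + 1) * (1 - X) = 2 := by
    rw [add_mul, cayley_mul h]
    noncomm_ring
    simp
  have h2 : cayley X + 1 = 2 * Ring.inverse (1 - X) := by
    rw [← h1, mul_assoc, Ring.mul_inverse_cancel _ h, mul_one]
  rw [h2]
  exact (isUnit_two A).mul h.ringInverse

theorem cayleyInv_cayley {X : A} (h : IsUnit (1 - X)) : cayleyInv (cayley X) = X := by
  have h1 := isUnit_cayley_add_one h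
  apply h1.mul_left_injective
  change cayleyInv (cayley X) * (cayley X + 1) = X * (cayley X + 1)
  rw [cayleyInv_mul h1]
  have h2 := mul_cayley h
  have h3 : cayley X - X * cayley X = 1 + X := by rw [← h2]; noncomm_ring
  rw [mul_add, mul_one, ← sub_eq_zero]
  have h4 : cayley X - 1 - (X * cayley X + X) = (cayley X - X * cayley X) - (1 + X) := by
    noncomm_ring
  rw [h4, h3, sub_self]

omit [Algebra ℝ A] in
theorem one_sub_cayleyInv_mul {R : A} (h : IsUnit (R + 1)) :
    (1 - cayleyInv R) * (R + 1) = 2 := by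
  rw [sub_mul, cayleyInv_mul h]
  noncomm_ring
  simp

theorem cayley_cayleyInv {R : A} (h : IsUnit (R + 1)) : cayley (cayleyInv R) = R := by
  have h2 : (1 - cayleyInv R) = 2 * Ring.inverse (R + 1) := by
    rw [← one_sub_cayleyInv_mul h, mul_assoc, Ring.mul_inverse_cancel _ h, mul_one]
  have h1 : IsUnit (1 - cayleyInv R) := by
    rw [h2]
    exact (isUnit_two A).mul h.ringInverse
  apply h1.mul_left_injective
  change cayley (cayleyInv R) * (1 - cayleyInv R) = R * (1 - cayleyInv R)
  rw [cayley_mul h1]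
  have h3 := mul_cayleyInv h
  rw [← sub_eq_zero]
  have h4 : 1 + cayleyInv R - R * (1 - cayleyInv R) = (R + 1) * cayleyInv R - (R - 1) := by
    noncomm_ring
  rw [h4, h3, sub_self]

end Cayley

/-! ### Cayley charts on subgroups of a unitary group -/

section CayleyCharts

variable {E A : Type} [NormedAddCommGroup E] [NormedSpace ℝ E] [NormedRing A] [NormedAlgebra ℝ A]
  [CompleteSpace A]

theorem contDiffAt_cayley {X : A} (h : IsUnit (1 - X)) : ContDiffAt ℝ ∞ (cayley : A → A) X := by
  obtain ⟨u, hu⟩ := h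
  have h1 : ContDiffAt ℝ ∞ Ring.inverse (1 - X) := hu ▸ contDiffAt_ringInverse ℝ u
  exact (contDiffAt_const.add contDiffAt_id).mul
    (h1.comp X (contDiffAt_const.sub contDiffAt_id))

theorem contDiffAt_cayleyInv {R : A} (h : IsUnit (R + 1)) :
    ContDiffAt ℝ ∞ (cayleyInv : A → A) R := by
  obtain ⟨u, hu⟩ := h
  have h1 : ContDiffAt ℝ ∞ Ring.inverse (R + 1) := hu ▸ contDiffAt_ringInverse ℝ u
  exact (contDiffAt_id.sub contDiffAt_const).mul
    (h1.comp R (contDiffAt_id.add contDiffAt_const))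

omit [NormedAlgebra ℝ A] [CompleteSpace A] in
theorem cayley_zero : cayley (0 : A) = 1 := by simp [cayley]

theorem hasFDerivAt_cayley_zero :
    HasFDerivAt (cayley : A → A) ((2 : ℝ) • ContinuousLinearMap.id ℝ A) 0 := by
  have h0 : HasFDerivAt (fun X : A => 1 - X) (- ContinuousLinearMap.id ℝ A) 0 :=
    (hasFDerivAt_id 0).const_sub 1
  have h1 : HasFDerivAt (Ring.inverse : A → A) (- ContinuousLinearMap.id ℝ A) (1 - 0) := by
    have := hasFDerivAt_ringInverse (𝕜 := ℝ) (1 : Aˣ)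
    rw [sub_zero]
    convert! this using 1
    ext X
    simp
  have h2 := ((hasFDerivAt_id (𝕜 := ℝ) (0 : A)).const_add 1).mul' (h1.comp 0 h0)
  convert! h2 using 1
  ext X
  simp [two_smul]

variable [StarRing A] [StarModule ℝ A]

/-- A subset `M` of the unitary group of an algebra, stable under multiplication by Cayley
transforms of skew elements, is a framed submanifold, for the frame `q ↦ q L_q` determined by
isomorphisms `L_q` from `E` to the space of skew elements; `K_q` is the inverse of `L_q`. The
parametrization at `q` is `s ↦ q cay(L_q s / 2)`, the factor `1/2` making up for the derivative of
the Cayley transform at `0`, which is twice the identity. -/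
noncomputable def FramedSubmanifold.ofCayley (M : Set A) (L : A → E →L[ℝ] A) (K : A → A →L[ℝ] E)
    (hunit : ∀ X : A, star X = -X → IsUnit (1 - X))
    (hM : ∀ q ∈ M, star q * q = 1 ∧ q * star q = 1)
    (hmul : ∀ q ∈ M, ∀ X, star X = -X → q * cayley X ∈ M)
    (hL : ContDiff ℝ ∞ L) (hskew : ∀ q ∈ M, ∀ v, star (L q v) = - L q v)
    (hKL : ∀ q ∈ M, ∀ v, K q (L q v) = v)
    (hLK : ∀ q ∈ M, ∀ X, star X = -X → L q (K q X) = X) : FramedSubmanifold E A where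
  carrier := M
  frame w := (ContinuousLinearMap.mul ℝ A w).comp (L w)
  param q s := q * cayley ((1 / 2 : ℝ) • L q s)
  nbhd q := {w | IsUnit (star (q : A) * w + 1)}
  coord q w := K q ((2 : ℝ) • cayleyInv (star (q : A) * w))
  contDiff_frame := (ContinuousLinearMap.contDiff _).clm_comp hL
  contDiff_param q := by
    rw [contDiff_iff_contDiffAt]
    intro s
    refine contDiffAt_const.mul (ContDiffAt.comp s (contDiffAt_cayley ?_) ?_)
    · exact hunit _ (by rw [star_smul, hskew q q.2]; simp)
    · exact ((L q).contDiff.const_smul _).contDiffAt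
  param_mem q s := hmul q q.2 _ (by rw [star_smul, hskew q q.2]; simp)
  param_mem_nbhd q s := by
    rw [mem_ofPred_eq, ← mul_assoc, (hM q q.2).1, one_mul]
    exact isUnit_cayley_add_one (hunit _ (by rw [star_smul, hskew q q.2]; simp))
  param_zero q := by rw [map_zero, smul_zero, cayley_zero, mul_one]
  hasFDerivAt_param q := by
    have h1 : HasFDerivAt (fun s => (1 / 2 : ℝ) • L q s) ((1 / 2 : ℝ) • L q) 0 :=
      ((1 / 2 : ℝ) • L q).hasFDerivAt
    have h2 : HasFDerivAt (cayley : A → A) ((2 : ℝ) • ContinuousLinearMap.id ℝ A)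
        ((1 / 2 : ℝ) • L q (0 : E)) := by
      rw [map_zero, smul_zero]
      exact hasFDerivAt_cayley_zero
    have h3 := (h2.comp 0 h1).const_mul (q : A)
    convert! h3 using 1
    ext s
    simp [smul_smul]
  isOpen_nbhd q := by
    refine Units.isOpen.preimage (f := fun w => star (q : A) * w + 1) ?_
    fun_prop
  contDiffOn_coord q := by
    intro w hw
    refine ContDiffAt.contDiffWithinAt ?_
    refine ContDiffAt.comp (g := (K q).comp ((2 : ℝ) • ContinuousLinearMap.id ℝ A)) w
      (ContinuousLinearMap.contDiff _).contDiffAt ?_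
    exact (contDiffAt_cayleyInv hw).comp w (contDiffAt_const.mul contDiffAt_id)
  coord_param q s := by
    rw [← mul_assoc, (hM q q.2).1, one_mul, cayleyInv_cayley, smul_smul]
    · norm_num
      exact hKL q q.2 s
    · exact hunit _ (by rw [star_smul, hskew q q.2]; simp)
  param_coord q w hw hwn := by
    have h1 : star (star (q : A) * w) * (star (q : A) * w) = 1 := by
      rw [star_mul, star_star, mul_assoc, ← mul_assoc (q : A), (hM q q.2).2, one_mul, (hM w hw).1]
    have h2 : star (cayleyInv (star (q : A) * w)) = - cayleyInv (star (q : A) * w) :=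
      star_cayleyInv h1 hwn
    rw [hLK q q.2 _ (by rw [star_smul, h2]; simp), smul_smul]
    norm_num
    rw [cayley_cayleyInv hwn, ← mul_assoc, (hM q q.2).2, one_mul]

end CayleyCharts

/-! ### The Lie algebra of rigid motions -/

section MotionAlgebra

open Matrix

/-- The space `𝔰𝔬(d)` of skew-symmetric matrices. -/
def skewMatrices (d : ℕ) : Submodule ℝ (Matrix (Fin d) (Fin d) ℝ) where
  carrier := {X | Xᵀ = -X}
  zero_mem' := by simp
  add_mem' := by
    intro X Y hX hY
    simp only [mem_ofPred_eq] at *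
    rw [transpose_add, hX, hY]; abel
  smul_mem' := by
    intro r X hX
    simp only [mem_ofPred_eq] at *
    rw [transpose_smul, hX, smul_neg]

variable {d : ℕ}

theorem mem_skewMatrices {X : Matrix (Fin d) (Fin d) ℝ} : X ∈ skewMatrices d ↔ Xᵀ = -X := Iff.rfl

theorem skew_mulVec_dotProduct {X : Matrix (Fin d) (Fin d) ℝ} (hX : X ∈ skewMatrices d)
    (y z : Fin d → ℝ) : (X *ᵥ y) ⬝ᵥ z = - (y ⬝ᵥ (X *ᵥ z)) := by
  rw [dotProduct_comm, dotProduct_mulVec, ← mulVec_transpose, mem_skewMatrices.1 hX, neg_mulVec,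
    neg_dotProduct, dotProduct_comm]

theorem skew_mulVec_dotProduct_self {X : Matrix (Fin d) (Fin d) ℝ} (hX : X ∈ skewMatrices d)
    (y : Fin d → ℝ) : (X *ᵥ y) ⬝ᵥ y = 0 := by
  have h := skew_mulVec_dotProduct hX y y
  rw [dotProduct_comm y] at h
  linarith

theorem lie_mem_skewMatrices {X Y : Matrix (Fin d) (Fin d) ℝ} (hX : X ∈ skewMatrices d)
    (hY : Y ∈ skewMatrices d) : X * Y - Y * X ∈ skewMatrices d := by
  rw [mem_skewMatrices] at *
  rw [transpose_sub, transpose_mul, transpose_mul, hX, hY]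
  noncomm_ring

theorem real_dotProduct_self_nonneg {n : Type*} [Fintype n] (v : n → ℝ) : 0 ≤ v ⬝ᵥ v :=
  Finset.sum_nonneg fun _ _ => mul_self_nonneg _

variable (d) in
/-- The space `𝔰𝔬(d) × ℝ^d` of infinitesimal rigid motions. It is a type of its own so as to carry a
Euclidean norm rather than the norm of the product. -/
def MotionAlgebra : Type := skewMatrices d × (Fin d → ℝ)

namespace MotionAlgebra

noncomputable instance : AddCommGroup (MotionAlgebra d) :=
  inferInstanceAs (AddCommGroup (skewMatrices d × (Fin d → ℝ)))

noncomputable instance : Module ℝ (MotionAlgebra d) :=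
  inferInstanceAs (Module ℝ (skewMatrices d × (Fin d → ℝ)))

instance : FiniteDimensional ℝ (MotionAlgebra d) :=
  inferInstanceAs (FiniteDimensional ℝ (skewMatrices d × (Fin d → ℝ)))

/-- The rotational part. -/
noncomputable def rot : MotionAlgebra d →ₗ[ℝ] Matrix (Fin d) (Fin d) ℝ :=
  (skewMatrices d).subtype ∘ₗ LinearMap.fst ℝ (skewMatrices d) (Fin d → ℝ)

/-- The translational part. -/
noncomputable def vec : MotionAlgebra d →ₗ[ℝ] (Fin d → ℝ) :=
  LinearMap.snd ℝ (skewMatrices d) (Fin d → ℝ)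

/-- The element with given parts. -/
noncomputable def mk (X : Matrix (Fin d) (Fin d) ℝ) (hX : X ∈ skewMatrices d) (y : Fin d → ℝ) :
    MotionAlgebra d := (⟨X, hX⟩, y)

theorem rot_mk (X : Matrix (Fin d) (Fin d) ℝ) (hX : X ∈ skewMatrices d) (y : Fin d → ℝ) :
    rot (mk X hX y) = X := rfl

theorem vec_mk (X : Matrix (Fin d) (Fin d) ℝ) (hX : X ∈ skewMatrices d) (y : Fin d → ℝ) :
    vec (mk X hX y) = y := rfl

theorem rot_mem (v : MotionAlgebra d) : rot v ∈ skewMatrices d := v.1.2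

theorem ext' {v w : MotionAlgebra d} (h1 : rot v = rot w) (h2 : vec v = vec w) : v = w :=
  Prod.ext (Subtype.ext h1) h2

/-- The inner product `tr(Ωᵀ Ω') + y · y'`. -/
@[reducible] noncomputable def innerCore : InnerProductSpace.Core ℝ (MotionAlgebra d) where
  inner v w := ((rot v)ᵀ * rot w).trace + vec v ⬝ᵥ vec w
  conj_inner_symm v w := by
    simp only [conj_trivial]
    rw [dotProduct_comm, ← Matrix.trace_transpose, transpose_mul, transpose_transpose]
  re_inner_nonneg v := by
    simp only [RCLike.re_to_real]
    refine add_nonneg ?_ (real_dotProduct_self_nonneg _)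
    rw [← Matrix.vec_dotProduct_vec]
    exact real_dotProduct_self_nonneg _
  add_left u v w := by
    simp only [map_add, transpose_add, add_mul, trace_add, add_dotProduct]
    ring
  smul_left v w r := by
    simp only [map_smul, transpose_smul, smul_mul, trace_smul, smul_dotProduct, smul_eq_mul,
      conj_trivial]
    ring
  definite v hv := by
    have h1 : 0 ≤ ((rot v)ᵀ * rot v).trace := by
      rw [← Matrix.vec_dotProduct_vec]
      exact real_dotProduct_self_nonneg _
    have h2 : 0 ≤ vec v ⬝ᵥ vec v := real_dotProduct_self_nonneg _
    apply ext'
    · have h3 : ((rot v)ᵀ * rot v).trace = 0 := by linarith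
      rw [← Matrix.vec_dotProduct_vec, dotProduct_self_eq_zero] at h3
      rw [map_zero]
      exact Matrix.vec_inj.1 (by rw [h3]; rfl)
    · rw [map_zero]
      exact dotProduct_self_eq_zero.1 (by linarith)

noncomputable instance : NormedAddCommGroup (MotionAlgebra d) :=
  innerCore.toNormedAddCommGroup

noncomputable instance : InnerProductSpace ℝ (MotionAlgebra d) :=
  InnerProductSpace.ofCore innerCore.toCore

theorem inner_def (v w : MotionAlgebra d) :
    inner ℝ v w = ((rot v)ᵀ * rot w).trace + vec v ⬝ᵥ vec w := rfl

/-- The bracket of rigid motions, `[(Ω, y), (Ω', y')] = (ΩΩ' - Ω'Ω, Ωy' - Ω'y)`. -/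
noncomputable def bracket : MotionAlgebra d →ₗ[ℝ] MotionAlgebra d →ₗ[ℝ] MotionAlgebra d :=
  LinearMap.mk₂ ℝ
    (fun v w => mk (rot v * rot w - rot w * rot v) (lie_mem_skewMatrices (rot_mem v) (rot_mem w))
      (rot v *ᵥ vec w - rot w *ᵥ vec v))
    (by
      intro u v w
      apply ext'
      · simp only [map_add, rot_mk]; noncomm_ring
      · simp only [map_add, vec_mk, add_mulVec, mulVec_add]; abel)
    (by
      intro r v w
      apply ext'
      · simp only [map_smul, rot_mk, smul_mul_assoc, mul_smul_comm, smul_sub]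
      · simp only [map_smul, vec_mk, smul_mulVec, mulVec_smul, smul_sub])
    (by
      intro u v w
      apply ext'
      · simp only [map_add, rot_mk]; noncomm_ring
      · simp only [map_add, vec_mk, add_mulVec, mulVec_add]; abel)
    (by
      intro r v w
      apply ext'
      · simp only [map_smul, rot_mk, smul_mul_assoc, mul_smul_comm, smul_sub]
      · simp only [map_smul, vec_mk, smul_mulVec, mulVec_smul, smul_sub])

theorem rot_bracket (v w : MotionAlgebra d) :
    rot (bracket v w) = rot v * rot w - rot w * rot v := rfl

theorem vec_bracket (v w : MotionAlgebra d) :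
    vec (bracket v w) = rot v *ᵥ vec w - rot w *ᵥ vec v := rfl

/-- The Lie algebra of rigid motions is unimodular: `ad(Ω, y)` is the sum of a skew map and of the
square-zero map `(Ω', y') ↦ (0, -Ω'y)`. -/
theorem trace_bracket (v : MotionAlgebra d) :
    LinearMap.trace ℝ (MotionAlgebra d) (bracket v) = 0 := by
  let T : MotionAlgebra d →ₗ[ℝ] MotionAlgebra d :=
    { toFun := fun w => mk 0 (zero_mem _) (rot w *ᵥ vec v)
      map_add' := by
        intro w w'
        apply ext'
        · simp [rot_mk]
        · simp [vec_mk, add_mulVec]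
      map_smul' := by
        intro r w
        apply ext'
        · simp [rot_mk]
        · simp [vec_mk, smul_mulVec] }
  have hT : LinearMap.trace ℝ (MotionAlgebra d) T = 0 := by
    refine (LinearMap.isNilpotent_trace_of_isNilpotent ⟨2, ?_⟩).eq_zero
    ext w : 1
    rw [pow_two, Module.End.mul_apply]
    apply ext'
    · rfl
    · change rot (T w) *ᵥ vec v = 0
      have : rot (T w) = 0 := rfl
      rw [this, zero_mulVec]
  have hS : LinearMap.trace ℝ (MotionAlgebra d) (bracket v + T) = 0 := by
    apply trace_eq_zero_of_skew
    intro w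
    have h1 : rot ((bracket v + T) w) = rot v * rot w - rot w * rot v := by
      rw [LinearMap.add_apply, map_add, rot_bracket]
      exact add_zero _
    have h2 : vec ((bracket v + T) w) = rot v *ᵥ vec w := by
      rw [LinearMap.add_apply, map_add, vec_bracket]
      exact sub_add_cancel _ _
    rw [inner_def, h1, h2, skew_mulVec_dotProduct_self (rot_mem v), add_zero,
      mem_skewMatrices.1 (lie_mem_skewMatrices (rot_mem v) (rot_mem w)), neg_mul, sub_mul,
      trace_neg, trace_sub, mul_assoc (rot w), Matrix.trace_mul_comm (rot w), sub_self, neg_zero]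
  rw [map_add, hT, add_zero] at hS
  exact hS

end MotionAlgebra

end MotionAlgebra

/-! ### The framed manifold `SO(d) × T^d` -/

section MotionManifold

open Matrix MotionAlgebra

/-- The algebra `Mat_d(ℝ) × ℂ^d`, a type of its own so as to be normed by the `ℓ^∞` operator norm of
matrices; any algebra norm would do. -/
def MatrixTorusAlgebra (d : ℕ) : Type := Matrix (Fin d) (Fin d) ℝ × (Fin d → ℂ)

section Instances

attribute [local instance] Matrix.linftyOpNormedRing Matrix.linftyOpNormedAlgebra

noncomputable instance (d : ℕ) : NormedRing (MatrixTorusAlgebra d) :=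
  inferInstanceAs (NormedRing (Matrix (Fin d) (Fin d) ℝ × (Fin d → ℂ)))

noncomputable instance (d : ℕ) : NormedAlgebra ℝ (MatrixTorusAlgebra d) :=
  inferInstanceAs (NormedAlgebra ℝ (Matrix (Fin d) (Fin d) ℝ × (Fin d → ℂ)))

noncomputable instance (d : ℕ) : StarRing (MatrixTorusAlgebra d) :=
  inferInstanceAs (StarRing (Matrix (Fin d) (Fin d) ℝ × (Fin d → ℂ)))

instance (d : ℕ) : StarModule ℝ (MatrixTorusAlgebra d) :=
  inferInstanceAs (StarModule ℝ (Matrix (Fin d) (Fin d) ℝ × (Fin d → ℂ)))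

instance (d : ℕ) : FiniteDimensional ℝ (MatrixTorusAlgebra d) :=
  inferInstanceAs (FiniteDimensional ℝ (Matrix (Fin d) (Fin d) ℝ × (Fin d → ℂ)))

instance (d : ℕ) : CompleteSpace (MatrixTorusAlgebra d) :=
  FiniteDimensional.complete ℝ _

end Instances

namespace MatrixTorusAlgebra

variable {d : ℕ}

/-- The element of `Mat_d(ℝ) × ℂ^d` with given components. -/
def mk (X : Matrix (Fin d) (Fin d) ℝ) (z : Fin d → ℂ) : MatrixTorusAlgebra d := (X, z)

theorem mk_add (X Y : Matrix (Fin d) (Fin d) ℝ) (z w : Fin d → ℂ) :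
    mk X z + mk Y w = mk (X + Y) (z + w) := rfl

theorem smul_mk (r : ℝ) (X : Matrix (Fin d) (Fin d) ℝ) (z : Fin d → ℂ) :
    r • mk X z = mk (r • X) (r • z) := rfl

theorem mk_mul (X Y : Matrix (Fin d) (Fin d) ℝ) (z w : Fin d → ℂ) :
    mk X z * mk Y w = mk (X * Y) (z * w) := rfl

theorem mk_sub (X Y : Matrix (Fin d) (Fin d) ℝ) (z w : Fin d → ℂ) :
    mk X z - mk Y w = mk (X - Y) (z - w) := rfl

theorem fst_add (q p : MatrixTorusAlgebra d) : (q + p).1 = q.1 + p.1 := rfl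

theorem fst_smul (r : ℝ) (q : MatrixTorusAlgebra d) : (r • q).1 = r • q.1 := rfl

theorem snd_smul (r : ℝ) (q : MatrixTorusAlgebra d) : (r • q).2 = r • q.2 := rfl

end MatrixTorusAlgebra

/-- The subgroup `SO(d) × T^d` of `Mat_d(ℝ) × ℂ^d`. -/
def motionSet (d : ℕ) : Set (MatrixTorusAlgebra d) :=
  {q | q.1 ∈ specialOrthogonalGroup (Fin d) ℝ ∧ ∀ i, ‖q.2 i‖ = 1}

variable {d : ℕ}

theorem star_mul_self_of_mem_motionSet {q : MatrixTorusAlgebra d} (hq : q ∈ motionSet d) :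
    star q * q = 1 ∧ q * star q = 1 := by
  have h := (mem_specialOrthogonalGroup_iff.1 hq.1).1
  have hz : ∀ i, star (q.2 i) * q.2 i = 1 := by
    intro i
    have := Complex.conj_mul' (q.2 i)
    rw [hq.2 i] at this
    simpa using this
  refine ⟨Prod.ext ((mem_orthogonalGroup_iff' _ _).1 h) (funext hz),
    Prod.ext ((mem_orthogonalGroup_iff _ _).1 h) (funext fun i => ?_)⟩
  exact (mul_comm _ _).trans (hz i)

theorem fst_mem_skewMatrices {X : MatrixTorusAlgebra d} (hX : star X = -X) :
    X.1 ∈ skewMatrices d := by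
  have := congrArg Prod.fst hX
  rw [mem_skewMatrices, ← conjTranspose_eq_transpose_of_trivial]
  exact this

theorem snd_re_eq_zero {X : MatrixTorusAlgebra d} (hX : star X = -X) (i : Fin d) :
    (X.2 i).re = 0 := by
  have h : star (X.2 i) = - X.2 i := congrFun (congrArg Prod.snd hX) i
  have := congrArg Complex.re h
  simp at this
  linarith

theorem isUnit_one_sub_skew {S : Matrix (Fin d) (Fin d) ℝ} (hS : S ∈ skewMatrices d) :
    IsUnit (1 - S) := by
  rw [← mulVec_injective_iff_isUnit]
  refine (injective_iff_map_eq_zero (Matrix.mulVecLin (1 - S))).2 fun v hv => ?_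
  rw [mulVecLin_apply, sub_mulVec, one_mulVec, sub_eq_zero] at hv
  have h := skew_mulVec_dotProduct_self hS v
  rw [← hv] at h
  exact dotProduct_self_eq_zero.1 h

theorem isUnit_one_sub_of_star_eq_neg {X : MatrixTorusAlgebra d} (hX : star X = -X) :
    IsUnit (1 - X) := by
  refine Prod.isUnit_iff.2 ⟨isUnit_one_sub_skew (fst_mem_skewMatrices hX),
    Pi.isUnit_iff.2 fun i => isUnit_iff_ne_zero.2 fun h => ?_⟩
  have h2 : (1 - X.2 i).re = 0 := by
    have : (1 - X).2 i = 1 - X.2 i := rfl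
    rw [← this, h, Complex.zero_re]
  rw [Complex.sub_re, snd_re_eq_zero hX] at h2
  norm_num at h2

theorem mul_cayley_mem_motionSet {q X : MatrixTorusAlgebra d} (hq : q ∈ motionSet d)
    (hX : star X = -X) : q * cayley X ∈ motionSet d := by
  have hu := isUnit_one_sub_of_star_eq_neg hX
  have h1 : star (cayley X) * cayley X = 1 := star_cayley_mul hX hu
  have h2 : (cayley X).1 * (1 - X.1) = 1 + X.1 := congrArg Prod.fst (cayley_mul hu)
  have h3 := fst_mem_skewMatrices hX
  have h4 : (1 + X.1).det = (1 - X.1).det := by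
    rw [← det_transpose, transpose_add, transpose_one, mem_skewMatrices.1 h3, sub_eq_add_neg]
  have h5 : (1 - X.1).det ≠ 0 := ((isUnit_iff_isUnit_det _).1 (isUnit_one_sub_skew h3)).ne_zero
  have h6 : (cayley X).1.det = 1 := by
    have := congrArg det h2
    rw [det_mul, h4] at this
    exact mul_right_cancel₀ h5 (this.trans (one_mul _).symm)
  refine ⟨mul_mem hq.1 (mem_specialOrthogonalGroup_iff.2
    ⟨(mem_orthogonalGroup_iff' _ _).2 (congrArg Prod.fst h1), h6⟩), fun i => ?_⟩
  have h7 : star ((cayley X).2 i) * (cayley X).2 i = 1 := congrFun (congrArg Prod.snd h1) i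
  have h8 : ‖(cayley X).2 i‖ * ‖(cayley X).2 i‖ = 1 := by
    have := congrArg norm h7
    rwa [norm_mul, norm_star, norm_one] at this
  have h9 : ‖(cayley X).2 i‖ = 1 := by nlinarith [norm_nonneg ((cayley X).2 i)]
  change ‖q.2 i * (cayley X).2 i‖ = 1
  rw [norm_mul, hq.2 i, h9, one_mul]

theorem one_mem_motionSet : (1 : MatrixTorusAlgebra d) ∈ motionSet d :=
  ⟨one_mem _, fun _ => norm_one⟩

theorem isCompact_motionSet : IsCompact (motionSet d) := by
  have hK : IsCompact ((univ.pi fun _ => univ.pi fun _ => Icc (-1) 1 : Set (Fin d → Fin d → ℝ)) ×ˢ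
      (univ.pi fun _ => Metric.sphere 0 1 : Set (Fin d → ℂ))) :=
    (isCompact_univ_pi fun _ => isCompact_univ_pi fun _ => isCompact_Icc).prod
      (isCompact_univ_pi fun _ => isCompact_sphere _ _)
  refine IsCompact.of_isClosed_subset (X := MatrixTorusAlgebra d) hK ?_ ?_
  · have : motionSet d = {q | q.1ᵀ * q.1 = 1} ∩ {q | q.1.det = 1} ∩
        ⋂ i, {q | ‖q.2 i‖ = 1} := by
      ext q
      simp [motionSet, mem_specialOrthogonalGroup_iff, mem_orthogonalGroup_iff']
    rw [this]
    refine IsClosed.inter (IsClosed.inter ?_ ?_) (isClosed_iInter fun i => ?_)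
    · exact isClosed_eq (f := fun q : MatrixTorusAlgebra d => q.1ᵀ * q.1)
        (continuous_fst.matrix_transpose.matrix_mul continuous_fst) continuous_const
    · exact isClosed_eq (Continuous.matrix_det continuous_fst) continuous_const
    · exact isClosed_eq (f := fun q : MatrixTorusAlgebra d => ‖q.2 i‖)
        ((continuous_apply i).comp continuous_snd).norm continuous_const
  · intro q hq
    refine ⟨fun i _ j _ => ?_, fun i _ => by simpa using hq.2 i⟩
    have := entry_norm_bound_of_unitary (𝕜 := ℝ) (mem_specialOrthogonalGroup_iff.1 hq.1).1 i j
    rw [Real.norm_eq_abs] at this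
    exact abs_le.1 this

/-- The vector `i x ∈ ℂ^d`, for `x ∈ ℝ^d`. -/
def imagVec : (Fin d → ℝ) →ₗ[ℝ] (Fin d → ℂ) where
  toFun x k := Complex.I * (x k : ℂ)
  map_add' x y := by
    funext k
    simp [mul_add]
  map_smul' r x := by
    funext k
    simp only [Pi.smul_apply, smul_eq_mul, Complex.ofReal_mul, Complex.real_smul, RingHom.id_apply]
    ring

theorem imagVec_apply (x : Fin d → ℝ) (k : Fin d) : imagVec x k = Complex.I * (x k : ℂ) := rfl

/-- The linear map `(Ω, y) ↦ (Ω, i (Q y)_k)` at the point `w = (Q, z)`. Left multiplication by `w` turns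
it into the frame of `SO(d) × T^d` by rigid motions. -/
noncomputable def motionFrame (w : MatrixTorusAlgebra d) :
    MotionAlgebra d →L[ℝ] MatrixTorusAlgebra d :=
  LinearMap.toContinuousLinearMap
    { toFun := fun v => .mk (rot v) (imagVec (w.1 *ᵥ vec v))
      map_add' := by
        intro v v'
        rw [map_add, map_add, mulVec_add, map_add, MatrixTorusAlgebra.mk_add]
      map_smul' := by
        intro r v
        rw [map_smul, map_smul, mulVec_smul, map_smul, RingHom.id_apply,
          MatrixTorusAlgebra.smul_mk] }

theorem motionFrame_apply (w : MatrixTorusAlgebra d) (v : MotionAlgebra d) :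
    motionFrame w v = .mk (rot v) (imagVec (w.1 *ᵥ vec v)) := rfl

/-- The part of `w ↦ motionFrame w v` that is linear in `w`. -/
noncomputable def motionFrameDeriv (v : MotionAlgebra d) :
    MatrixTorusAlgebra d →L[ℝ] MatrixTorusAlgebra d :=
  LinearMap.toContinuousLinearMap
    { toFun := fun w => .mk 0 (imagVec (w.1 *ᵥ vec v))
      map_add' := by
        intro w w'
        rw [MatrixTorusAlgebra.fst_add, add_mulVec, map_add, MatrixTorusAlgebra.mk_add, add_zero]
      map_smul' := by
        intro r w
        rw [MatrixTorusAlgebra.fst_smul, smul_mulVec, map_smul, RingHom.id_apply,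
          MatrixTorusAlgebra.smul_mk, smul_zero] }

theorem motionFrameDeriv_apply (v : MotionAlgebra d) (w : MatrixTorusAlgebra d) :
    motionFrameDeriv v w = .mk 0 (imagVec (w.1 *ᵥ vec v)) := rfl

theorem motionFrame_eq (w : MatrixTorusAlgebra d) (v : MotionAlgebra d) :
    motionFrame w v = .mk (rot v) 0 + motionFrameDeriv v w := by
  rw [motionFrame_apply, motionFrameDeriv_apply, MatrixTorusAlgebra.mk_add, add_zero, zero_add]

theorem hasFDerivAt_motionFrame (v : MotionAlgebra d) (w : MatrixTorusAlgebra d) :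
    HasFDerivAt (fun w => motionFrame w v) (motionFrameDeriv v) w := by
  simp only [motionFrame_eq]
  exact (motionFrameDeriv v).hasFDerivAt.const_add _

theorem contDiff_motionFrame :
    ContDiff ℝ ∞ (motionFrame : MatrixTorusAlgebra d → _) := by
  rw [contDiff_clm_apply_iff]
  intro v
  simp only [motionFrame_eq]
  exact contDiff_const.add (motionFrameDeriv v).contDiff

theorem star_motionFrame (w : MatrixTorusAlgebra d) (v : MotionAlgebra d) :
    star (motionFrame w v) = - motionFrame w v := by
  refine Prod.ext ?_ (funext fun k => ?_)
  · change (rot v)ᴴ = - rot v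
    rw [conjTranspose_eq_transpose_of_trivial]
    exact rot_mem v
  · change star (imagVec (w.1 *ᵥ vec v) k) = - imagVec (w.1 *ᵥ vec v) k
    simp [imagVec_apply]

theorem sub_transpose_mem_skewMatrices (X : Matrix (Fin d) (Fin d) ℝ) :
    (1 / 2 : ℝ) • (X - Xᵀ) ∈ skewMatrices d := by
  rw [mem_skewMatrices, transpose_smul, transpose_sub, transpose_transpose, ← smul_neg, neg_sub]

/-- The inverse of `motionFrame w`, on skew elements, when `w` lies in `SO(d) × T^d`. The matrix is
antisymmetrized in order to define the map on the whole algebra. -/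
noncomputable def motionCoframe (w : MatrixTorusAlgebra d) :
    MatrixTorusAlgebra d →L[ℝ] MotionAlgebra d :=
  LinearMap.toContinuousLinearMap
    { toFun := fun X => mk ((1 / 2 : ℝ) • (X.1 - X.1ᵀ)) (sub_transpose_mem_skewMatrices _)
        (w.1ᵀ *ᵥ fun k => (X.2 k).im)
      map_add' := by
        intro X Y
        apply ext'
        · simp only [map_add, rot_mk, MatrixTorusAlgebra.fst_add, transpose_add, ← smul_add]
          congr 1
          abel
        · simp only [map_add, vec_mk, ← mulVec_add]
          rfl
      map_smul' := by
        intro r X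
        apply ext'
        · simp only [map_smul, rot_mk, MatrixTorusAlgebra.fst_smul, transpose_smul, ← smul_sub,
            RingHom.id_apply]
          rw [smul_comm]
        · simp only [map_smul, vec_mk, ← mulVec_smul, RingHom.id_apply]
          congr 1
          funext k
          rw [MatrixTorusAlgebra.snd_smul]
          simp }

theorem motionCoframe_apply (w X : MatrixTorusAlgebra d) :
    motionCoframe w X = mk ((1 / 2 : ℝ) • (X.1 - X.1ᵀ)) (sub_transpose_mem_skewMatrices _)
        (w.1ᵀ *ᵥ fun k => (X.2 k).im) := rfl

theorem half_sub_transpose {X : Matrix (Fin d) (Fin d) ℝ} (hX : X ∈ skewMatrices d) :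
    (1 / 2 : ℝ) • (X - Xᵀ) = X := by
  rw [mem_skewMatrices.1 hX, sub_neg_eq_add, ← two_smul ℝ, smul_smul]
  norm_num

theorem transpose_mul_self_of_mem_motionSet {q : MatrixTorusAlgebra d} (hq : q ∈ motionSet d) :
    q.1ᵀ * q.1 = 1 ∧ q.1 * q.1ᵀ = 1 := by
  rw [← conjTranspose_eq_transpose_of_trivial]
  exact ⟨congrArg Prod.fst (star_mul_self_of_mem_motionSet hq).1,
    congrArg Prod.fst (star_mul_self_of_mem_motionSet hq).2⟩

theorem motionCoframe_motionFrame {q : MatrixTorusAlgebra d} (hq : q ∈ motionSet d)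
    (v : MotionAlgebra d) : motionCoframe q (motionFrame q v) = v := by
  rw [motionCoframe_apply, motionFrame_apply]
  apply ext'
  · rw [rot_mk]
    exact half_sub_transpose (rot_mem v)
  · rw [vec_mk]
    have : (fun k => (imagVec (q.1 *ᵥ vec v) k).im) = q.1 *ᵥ vec v := by
      funext k
      simp [imagVec_apply]
    change q.1ᵀ *ᵥ (fun k => (imagVec (q.1 *ᵥ vec v) k).im) = vec v
    rw [this, mulVec_mulVec, (transpose_mul_self_of_mem_motionSet hq).1, one_mulVec]

theorem motionFrame_motionCoframe {q : MatrixTorusAlgebra d} (hq : q ∈ motionSet d)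
    {X : MatrixTorusAlgebra d} (hX : star X = -X) : motionFrame q (motionCoframe q X) = X := by
  rw [motionCoframe_apply, motionFrame_apply]
  refine Prod.ext ?_ (funext fun k => ?_)
  · exact half_sub_transpose (fst_mem_skewMatrices hX)
  · rw [vec_mk, mulVec_mulVec, (transpose_mul_self_of_mem_motionSet hq).2, one_mulVec]
    change imagVec (fun k => (X.2 k).im) k = X.2 k
    apply Complex.ext
    · simp [imagVec_apply, snd_re_eq_zero hX]
    · simp [imagVec_apply]

/-- The linear change of variables `(Ω, y) ↦ (Ω - a(y), y)`. -/
noncomputable def shear (a : (Fin d → ℝ) →ₗ[ℝ] skewMatrices d) :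
    MotionAlgebra d ≃ₗ[ℝ] MotionAlgebra d where
  toFun v := mk (rot v - a (vec v)) (sub_mem (rot_mem v) (a (vec v)).2) (vec v)
  invFun v := mk (rot v + a (vec v)) (add_mem (rot_mem v) (a (vec v)).2) (vec v)
  map_add' v w := by
    apply ext'
    · simp only [map_add, rot_mk, Submodule.coe_add]; abel
    · simp only [map_add, vec_mk]
  map_smul' r v := by
    apply ext'
    · simp only [map_smul, rot_mk, Submodule.coe_smul, smul_sub, RingHom.id_apply]
    · simp only [map_smul, vec_mk, RingHom.id_apply]
  left_inv v := by
    apply ext'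
    · simp only [rot_mk, vec_mk, sub_add_cancel]
    · rfl
  right_inv v := by
    apply ext'
    · simp only [rot_mk, vec_mk, add_sub_cancel_right]
    · rfl

theorem rot_shear (a : (Fin d → ℝ) →ₗ[ℝ] skewMatrices d) (v : MotionAlgebra d) :
    rot (shear a v) = rot v - a (vec v) := rfl

theorem vec_shear (a : (Fin d → ℝ) →ₗ[ℝ] skewMatrices d) (v : MotionAlgebra d) :
    vec (shear a v) = vec v := rfl

theorem vec_shear_symm (a : (Fin d → ℝ) →ₗ[ℝ] skewMatrices d) (v : MotionAlgebra d) :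
    vec ((shear a).symm v) = vec v := rfl

/-- The manifold `SO(d) × T^d` with the frame `(Q, z) ↦ (Q (Ω - a(y)), (i (Q y)_k z_k)_k)`. -/
noncomputable def motionManifold (a : (Fin d → ℝ) →ₗ[ℝ] skewMatrices d) :
    FramedSubmanifold (MotionAlgebra d) (MatrixTorusAlgebra d) :=
  FramedSubmanifold.ofCayley (motionSet d)
    (fun w => (motionFrame w).comp
      (LinearMap.toContinuousLinearMap (shear a : MotionAlgebra d →ₗ[ℝ] MotionAlgebra d)))
    (fun w => (LinearMap.toContinuousLinearMap
      ((shear a).symm : MotionAlgebra d →ₗ[ℝ] MotionAlgebra d)).comp (motionCoframe w))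
    (fun _ => isUnit_one_sub_of_star_eq_neg)
    (fun _ => star_mul_self_of_mem_motionSet)
    (fun _ hq _ hX => mul_cayley_mem_motionSet hq hX)
    (contDiff_motionFrame.clm_comp contDiff_const)
    (fun _ _ v => star_motionFrame _ _)
    (fun q hq v => by
      change (shear a).symm (motionCoframe q (motionFrame q (shear a v))) = v
      rw [motionCoframe_motionFrame hq, LinearEquiv.symm_apply_apply])
    (fun q hq X hX => by
      change motionFrame q (shear a ((shear a).symm (motionCoframe q X))) = X
      rw [LinearEquiv.apply_symm_apply, motionFrame_motionCoframe hq hX])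

end MotionManifold

/-! ### Quadratic systems `y' = a(y) y` as Euler flows -/

section MotionManifoldEuler

open Matrix MotionAlgebra

variable {d : ℕ} (a : (Fin d → ℝ) →ₗ[ℝ] skewMatrices d)

instance : CompactSpace (motionManifold a).carrier :=
  isCompact_iff_compactSpace.1 isCompact_motionSet

instance : Nonempty (motionManifold a).carrier := ⟨⟨1, one_mem_motionSet⟩⟩

theorem motionManifold_frame (w : MatrixTorusAlgebra d) (v : MotionAlgebra d) :
    (motionManifold a).frame w v = w * motionFrame w (shear a v) := rfl

/-- The bracket of rigid motions transported by the linear isomorphism `shear a`. -/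
noncomputable def shearBracket : MotionAlgebra d →ₗ[ℝ] MotionAlgebra d →ₗ[ℝ] MotionAlgebra d :=
  ((bracket.compr₂ ((shear a).symm : MotionAlgebra d →ₗ[ℝ] MotionAlgebra d)).compl₁₂
    (shear a : MotionAlgebra d →ₗ[ℝ] MotionAlgebra d)
    (shear a : MotionAlgebra d →ₗ[ℝ] MotionAlgebra d))

theorem shearBracket_apply (v w : MotionAlgebra d) :
    shearBracket a v w = (shear a).symm (bracket (shear a v) (shear a w)) := rfl

theorem shearBracket_self (v : MotionAlgebra d) : shearBracket a v v = 0 := by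
  rw [shearBracket_apply]
  have : bracket (shear a v) (shear a v) = 0 := by
    apply ext'
    · rw [rot_bracket, sub_self, map_zero]
    · rw [vec_bracket, sub_self, map_zero]
  rw [this, map_zero]

theorem trace_shearBracket (v : MotionAlgebra d) :
    LinearMap.trace ℝ (MotionAlgebra d) (shearBracket a v) = 0 := by
  have : shearBracket a v = (shear a).symm.conj (bracket (shear a v)) := by
    ext w
    rw [shearBracket_apply, LinearEquiv.conj_apply_apply, LinearEquiv.symm_symm]
  rw [this, LinearMap.trace_conj', trace_bracket]

theorem fderiv_motionManifold_frame (w X : MatrixTorusAlgebra d) (v : MotionAlgebra d) :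
    fderiv ℝ (fun x => (motionManifold a).frame x v) w X =
      w * motionFrameDeriv (shear a v) X + X * motionFrame w (shear a v) := by
  have h := (hasFDerivAt_id (𝕜 := ℝ) w).mul' (hasFDerivAt_motionFrame (shear a v) w)
  have h2 : HasFDerivAt (fun x => (motionManifold a).frame x v) _ w := h
  rw [h2.fderiv]
  rfl

/-- The structure constants of the frame of `motionManifold a` are given by `shearBracket a`. -/
theorem motionManifold_structure (q : (motionManifold a).carrier) (v w : MotionAlgebra d) :
    fderiv ℝ (fun x => (motionManifold a).frame x w) q ((motionManifold a).frame q v) -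
      fderiv ℝ (fun x => (motionManifold a).frame x v) q ((motionManifold a).frame q w) =
      (motionManifold a).frame q (shearBracket a v w) := by
  rw [fderiv_motionManifold_frame, fderiv_motionManifold_frame]
  simp only [motionManifold_frame, shearBracket_apply, LinearEquiv.apply_symm_apply]
  generalize shear a v = V
  generalize shear a w = W
  generalize (q : MatrixTorusAlgebra d) = p
  rw [mul_assoc, mul_assoc, ← mul_add, ← mul_add, ← mul_sub]
  congr 1
  simp only [motionFrame_apply, motionFrameDeriv_apply, MatrixTorusAlgebra.mk_mul,
    MatrixTorusAlgebra.mk_add, MatrixTorusAlgebra.mk_sub, zero_add, rot_bracket, vec_bracket]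
  congr 1
  rw [mul_comm (imagVec _) (imagVec _), add_sub_add_right_eq_sub, ← map_sub]
  congr 1
  have h : ∀ U : MotionAlgebra d, (p * (MatrixTorusAlgebra.mk (rot U) (imagVec (p.1 *ᵥ vec U)))).1
      = p.1 * rot U := fun _ => rfl
  rw [h, h, mulVec_sub, mulVec_mulVec, mulVec_mulVec]

theorem isSOTorus_motionManifold : (motionManifold a).toRiemannian.IsSOTorus d := by
  let J : MatrixTorusAlgebra d ≃L[ℝ] (Fin d → Fin d → ℝ) × (Fin d → ℂ) :=
    LinearEquiv.toContinuousLinearEquiv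
      { toFun := fun q => (fun i j => q.1 i j, q.2)
        invFun := fun q => (Matrix.of q.1, q.2)
        map_add' := fun _ _ => rfl
        map_smul' := fun _ _ => rfl
        left_inv := fun _ => rfl
        right_inv := fun _ => rfl }
  have hJ : ∀ q : (motionManifold a).carrier,
      HasMFDerivAt 𝓘(ℝ, MotionAlgebra d) 𝓘(ℝ, (Fin d → Fin d → ℝ) × (Fin d → ℂ))
        (fun q : (motionManifold a).carrier => J q) q
        ((J : MatrixTorusAlgebra d →L[ℝ] (Fin d → Fin d → ℝ) × (Fin d → ℂ)).comp
          ((motionManifold a).frame q) :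
          MotionAlgebra d →L[ℝ] (Fin d → Fin d → ℝ) × (Fin d → ℂ)) := fun q =>
    (J.hasFDerivAt (x := (q : MatrixTorusAlgebra d))).hasMFDerivAt.comp q
      ((motionManifold a).hasMFDerivAt_coe q)
  refine ⟨fun q : (motionManifold a).carrier => J q, ⟨?_, ?_, ?_⟩, ?_⟩
  · exact J.contDiff.contMDiff.comp (motionManifold a).contMDiff_coe
  · intro q
    rw [(hJ q).mfderiv]
    exact J.injective.comp ((motionManifold a).injective_frame q)
  · exact J.toHomeomorph.isEmbedding.comp IsEmbedding.subtypeVal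
  · ext p
    constructor
    · rintro ⟨q, rfl⟩
      exact q.2
    · intro hp
      exact ⟨⟨J.symm p, hp⟩, J.apply_symm_apply p⟩

/-- Solutions of a smooth autonomous differential equation are smooth. -/
theorem contDiff_of_hasDerivAt {B : (Fin d → ℝ) → (Fin d → ℝ)} (hB : ContDiff ℝ ∞ B)
    {y : ℝ → Fin d → ℝ} (hy : ∀ t, HasDerivAt y (B (y t)) t) : ContDiff ℝ ∞ y := by
  rw [contDiff_infty]
  intro k
  induction k with
  | zero =>
    exact contDiff_zero.2 (continuous_iff_continuousAt.2 fun t => (hy t).continuousAt)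
  | succ k ih =>
    rw [Nat.cast_succ]
    refine contDiff_succ_iff_deriv.2 ⟨fun t => (hy t).differentiableAt, by simp, ?_⟩
    have : deriv y = fun t => B (y t) := funext fun t => (hy t).deriv
    rw [this]
    exact (contDiff_infty.1 hB k).comp ih

theorem contDiff_mulVec_self : ContDiff ℝ ∞ fun y => (a y : Matrix (Fin d) (Fin d) ℝ) *ᵥ y := by
  rw [contDiff_pi]
  intro i
  have h : ∀ j, ContDiff ℝ ∞ fun y => (a y : Matrix (Fin d) (Fin d) ℝ) i j := by
    intro j
    let l : (Fin d → ℝ) →ₗ[ℝ] ℝ :=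
      { toFun := fun y => (a y : Matrix (Fin d) (Fin d) ℝ) i j
        map_add' := fun x y => by rw [map_add]; rfl
        map_smul' := fun r y => by rw [map_smul]; rfl }
    exact (LinearMap.toContinuousLinearMap l).contDiff
  change ContDiff ℝ ∞ fun y => ∑ j, (a y : Matrix (Fin d) (Fin d) ℝ) i j * y j
  exact ContDiff.sum fun j _ => (h j).mul (contDiff_apply ℝ ℝ j)

/-- The inclusion `y ↦ (0, y)` of `ℝ^d` in `𝔰𝔬(d) × ℝ^d`. -/
noncomputable def translation : (Fin d → ℝ) →ₗ[ℝ] MotionAlgebra d where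
  toFun y := mk 0 (zero_mem _) y
  map_add' _ _ := ext' (add_zero _).symm rfl
  map_smul' r _ := ext' (smul_zero r).symm rfl

theorem rot_translation (y : Fin d → ℝ) : rot (translation y) = 0 := rfl

theorem vec_translation (y : Fin d → ℝ) : vec (translation y) = y := rfl

/-- The identity behind `∇_u u = -(0, a(y) y)` for `u = (0, y)`. -/
theorem inner_shearBracket_translation (y : Fin d → ℝ) (w : MotionAlgebra d) :
    inner ℝ (translation y) (shearBracket a (translation y) w) =
      ((a y : Matrix (Fin d) (Fin d) ℝ) *ᵥ y) ⬝ᵥ vec w := by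
  have h1 : vec (shearBracket a (translation y) w) =
      - ((a y : Matrix (Fin d) (Fin d) ℝ) *ᵥ vec w) - rot (shear a w) *ᵥ y := by
    rw [shearBracket_apply, vec_shear_symm, vec_bracket, rot_shear, rot_translation,
      vec_shear, vec_shear, vec_translation, zero_sub, neg_mulVec]
  rw [inner_def, rot_translation, vec_translation, h1, transpose_zero, zero_mul, trace_zero,
    zero_add, dotProduct_sub, dotProduct_neg, skew_mulVec_dotProduct (a y).2,
    dotProduct_comm y (rot _ *ᵥ y), skew_mulVec_dotProduct_self (rot_mem _), sub_zero]

/-- The dynamics of `X` embeds in the Euler equations as soon as some embedding `f : N → ℝ^d`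
conjugates it to a system `y' = a(y) y`, with `a(y)` a skew matrix depending linearly on `y`. -/
theorem embedsInEuler_of_skew {F H N : Type} [NormedAddCommGroup F] [NormedSpace ℝ F]
    [TopologicalSpace H] {I : ModelWithCorners ℝ F H} [TopologicalSpace N] [ChartedSpace H N]
    {X : (x : N) → TangentSpace I x} {φ : ℝ → N → N} (hφ : IsGlobalFlow X φ)
    {f : N → Fin d → ℝ} (hf : IsSmoothEmbeddingIn I f)
    (hfd : ∀ x t, HasDerivAt (fun t => f (φ t x))
      ((a (f (φ t x)) : Matrix (Fin d) (Fin d) ℝ) *ᵥ f (φ t x)) t) :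
    EmbedsInEuler I X := by
  obtain ⟨Γ, h1, h2, h3, h4⟩ := exists_koszul (shearBracket a) (shearBracket_self a)
  refine (motionManifold a).embedsInEuler (isSOTorus_motionManifold a) (Γ := Γ) (ι := translation)
    (B := fun y => (a y : Matrix (Fin d) (Fin d) ℝ) *ᵥ y)
    (motionManifold_structure a) h1 h2 ?_ ?_ ?_ hφ hf ?_ hfd
  · intro x y hxy
    exact congrArg MotionAlgebra.vec hxy
  · intro y
    rw [h4, trace_shearBracket, neg_zero]
  · intro y
    refine ext_inner_right ℝ fun w => ?_
    rw [inner_add_left, h3, inner_shearBracket_translation, inner_def, rot_translation,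
      vec_translation, transpose_zero, zero_mul, trace_zero, zero_add, add_neg_cancel,
      inner_zero_left]
  · intro x
    exact contDiff_of_hasDerivAt (contDiff_mulVec_self a) (hfd x)

/-- The form of `embedsInEuler_of_skew` in which the functions are indexed by any finite type and the
skew matrix is given by its entries. -/
theorem embedsInEuler_of_antisymm {F H N κ : Type} [NormedAddCommGroup F] [NormedSpace ℝ F]
    [TopologicalSpace H] {I : ModelWithCorners ℝ F H} [TopologicalSpace N] [ChartedSpace H N]
    [Fintype κ] {X : (x : N) → TangentSpace I x} {φ : ℝ → N → N} (hφ : IsGlobalFlow X φ)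
    {f : N → κ → ℝ} (hf : IsSmoothEmbeddingIn I f) (A : κ → κ → (κ → ℝ) →ₗ[ℝ] ℝ)
    (hA : ∀ i j, A i j = - A j i)
    (hfd : ∀ x t i, HasDerivAt (fun t => f (φ t x) i)
      (∑ j, A i j (f (φ t x)) * f (φ t x) j) t) :
    EmbedsInEuler I X := by
  let e : κ ≃ Fin (Fintype.card κ) := Fintype.equivFin κ
  let T : (κ → ℝ) ≃L[ℝ] (Fin (Fintype.card κ) → ℝ) :=
    (LinearEquiv.funCongrLeft ℝ ℝ e.symm).toContinuousLinearEquiv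
  have hT : ∀ y i, T y i = y (e.symm i) := fun _ _ => rfl
  let a : (Fin (Fintype.card κ) → ℝ) →ₗ[ℝ] skewMatrices (Fintype.card κ) :=
    { toFun := fun y => ⟨Matrix.of fun i j => A (e.symm i) (e.symm j) (T.symm y), by
        rw [mem_skewMatrices]
        ext i j
        simp only [transpose_apply, of_apply]
        rw [hA]
        rfl⟩
      map_add' := by
        intro x y
        apply Subtype.ext
        ext i j
        simp
      map_smul' := by
        intro r x
        apply Subtype.ext
        ext i j
        simp }
  refine embedsInEuler_of_skew a hφ (f := fun x => T (f x)) ⟨?_, ?_, ?_⟩ ?_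
  · exact T.contDiff.contMDiff.comp hf.smooth
  · intro x
    have h := (T.hasFDerivAt (x := f x)).hasMFDerivAt.comp x
      ((hf.smooth x).mdifferentiableAt (by simp)).hasMFDerivAt
    have h' : HasMFDerivAt I 𝓘(ℝ, Fin (Fintype.card κ) → ℝ) (fun x => T (f x)) x _ := h
    rw [h'.mfderiv]
    exact T.injective.comp (hf.injective_mfderiv x)
  · exact T.toHomeomorph.isEmbedding.comp hf.isEmbedding
  · intro x t
    rw [hasDerivAt_pi]
    intro i
    refine (hfd x t (e.symm i)).congr_deriv ?_
    change _ = ∑ j, A (e.symm i) (e.symm j) (T.symm (T (f (φ t x)))) * f (φ t x) (e.symm j)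
    rw [T.symm_apply_apply]
    exact (e.symm.sum_comp fun j => A (e.symm i) j (f (φ t x)) * f (φ t x) j).symm

end MotionManifoldEuler

/-! ### Complete vector fields -/

section GlobalFlow

open scoped NNReal

/-- A bounded Lipschitz vector field of class `C¹` is complete. -/
theorem exists_global_solution {E : Type} [NormedAddCommGroup E] [NormedSpace ℝ E]
    [CompleteSpace E] {v : E → E} (hv : ContDiff ℝ 1 v) {K L : ℝ≥0} (hK : LipschitzWith K v)
    (hL : ∀ x, ‖v x‖ ≤ L) (x : E) : ∃ γ : ℝ → E, γ 0 = x ∧ ∀ t, HasDerivAt γ (v (γ t)) t := by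
  have h := (exists_isMIntegralCurve_iff_exists_isMIntegralCurveOn_Ioo (I := 𝓘(ℝ, E))
    (v := (v : (x : E) → TangentSpace 𝓘(ℝ, E) x)) (contMDiff_vectorSpace_iff_contDiff.2 hv) x).2 ?_
  · obtain ⟨γ, h0, hγ⟩ := h
    refine ⟨γ, h0, fun t => ?_⟩
    have h : HasFDerivAt γ ((1 : ℝ →L[ℝ] ℝ).smulRight (v (γ t))) t := (hγ t).hasFDerivAt
    simpa using h.hasDerivAt
  · intro a
    rcases le_or_gt a 0 with ha | ha
    · refine ⟨fun _ => x, rfl, fun t ht => ?_⟩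
      have := ht.1.trans ht.2
      linarith
    · have hPL : IsPicardLindelof (fun _ => v) (tmin := -a) (tmax := a) ⟨0, by simp [ha.le]⟩ x
          (L * a.toNNReal) 0 L K :=
        { lipschitzOnWith := fun _ _ => hK.lipschitzOnWith
          continuousOn := fun _ _ => continuousOn_const
          norm_le := fun _ _ y _ => hL y
          mul_max_le := by simp [ha.le] }
      obtain ⟨γ, h0, hγ⟩ := hPL.exists_eq_forall_mem_Icc_hasDerivWithinAt₀
      refine ⟨γ, h0, fun t ht => ?_⟩
      exact (((hγ t (Ioo_subset_Icc_self ht)).mono Ioo_subset_Icc_self).hasFDerivWithinAt).hasMFDerivWithinAt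

end GlobalFlow

/-! ### Trigonometric vector fields on the torus -/

section Torus

open scoped NNReal

variable {n : ℕ} {W : Type}

theorem torus_comp_extChartAt_symm (f : UnitAddTorus (Fin n) → W) (x : UnitAddTorus (Fin n)) :
    f ∘ (extChartAt 𝓘(ℝ, Fin n → ℝ) x).symm = f ∘ torusMk n := by
  funext y
  simp only [mfld_simps]
  rw [torus_chart_symm n (chart_mem_atlas _ x)]

variable [NormedAddCommGroup W] [NormedSpace ℝ W]

/-- A function on the torus is smooth if its lift to `ℝ^n` is. -/
theorem contMDiff_of_comp_torusMk {f : UnitAddTorus (Fin n) → W}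
    (hf : ContDiff ℝ ∞ (f ∘ torusMk n)) : ContMDiff 𝓘(ℝ, Fin n → ℝ) 𝓘(ℝ, W) ∞ f := by
  intro x
  have hq : IsQuotientMap (torusMk n) := (torusMk_isLocalHomeomorph n).isOpenMap.isQuotientMap
    (torusMk_isLocalHomeomorph n).continuous (torusMk_surjective n)
  rw [contMDiffAt_iff]
  refine ⟨(hq.continuous_iff.2 hf.continuous).continuousAt, ?_⟩
  rw [extChartAt_model_space_eq_id, torus_comp_extChartAt_symm]
  exact hf.contDiffAt.contDiffWithinAt

theorem mfderiv_torus_eq {f : UnitAddTorus (Fin n) → W} (hf : ContDiff ℝ ∞ (f ∘ torusMk n))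
    (x : UnitAddTorus (Fin n)) : mfderiv 𝓘(ℝ, Fin n → ℝ) 𝓘(ℝ, W) f x =
      fderiv ℝ (f ∘ torusMk n) (extChartAt 𝓘(ℝ, Fin n → ℝ) x x) := by
  rw [((contMDiff_of_comp_torusMk hf).mdifferentiable (by simp) x).mfderiv]
  rw [writtenInExtChartAt, extChartAt_model_space_eq_id, ← torus_comp_extChartAt_symm f x]
  simp only [mfld_simps, fderivWithin_univ]
  rfl

variable (n) in
/-- The linear form `y ↦ 2π k·y`. -/
noncomputable def phase (k : Fin n → ℤ) : (Fin n → ℝ) →L[ℝ] ℝ :=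
  (2 * Real.pi) • ∑ i, (k i : ℝ) • ContinuousLinearMap.proj i

theorem phase_apply (k : Fin n → ℤ) (y : Fin n → ℝ) :
    phase n k y = 2 * Real.pi * ∑ i, (k i : ℝ) * y i := by
  simp [phase]

theorem phase_single (i : Fin n) (y : Fin n → ℝ) :
    phase n (Pi.single i 1) y = 2 * Real.pi * y i := by
  rw [phase_apply, Finset.sum_eq_single i] <;> simp +contextual

/-- The trigonometric functions `cos (2π k·x)` (for `b = true`) and `sin (2π k·x)` (for
`b = false`) on the torus. -/
noncomputable def trigFun (k : Fin n → ℤ) (b : Bool) (x : UnitAddTorus (Fin n)) : ℝ :=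
  if b then (UnitAddTorus.mFourier k x).re else (UnitAddTorus.mFourier k x).im

theorem mFourier_torusMk (k : Fin n → ℤ) (y : Fin n → ℝ) :
    UnitAddTorus.mFourier k (torusMk n y) = Complex.exp (phase n k y * Complex.I) := by
  change ∏ i, fourier (k i) ((y i : ℝ) : UnitAddCircle) = _
  simp only [fourier_coe_apply, ← Complex.exp_sum, phase_apply]
  congr 1
  push_cast
  rw [Finset.mul_sum, Finset.sum_mul]
  refine Finset.sum_congr rfl fun i _ => ?_
  ring

theorem trigFun_true (k : Fin n → ℤ) (y : Fin n → ℝ) :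
    trigFun k true (torusMk n y) = Real.cos (phase n k y) := by
  simp [trigFun, mFourier_torusMk, Complex.exp_ofReal_mul_I_re]

theorem trigFun_false (k : Fin n → ℤ) (y : Fin n → ℝ) :
    trigFun k false (torusMk n y) = Real.sin (phase n k y) := by
  simp [trigFun, mFourier_torusMk, Complex.exp_ofReal_mul_I_im]

theorem eq_of_trigFun_eq {x x' : UnitAddTorus (Fin n)}
    (h : ∀ i b, trigFun (Pi.single i 1) b x = trigFun (Pi.single i 1) b x') : x = x' := by
  funext i
  have h1 : UnitAddTorus.mFourier (Pi.single i 1) x = UnitAddTorus.mFourier (Pi.single i 1) x' :=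
    Complex.ext (h i true) (h i false)
  rw [UnitAddTorus.mFourier_single, UnitAddTorus.mFourier_single, fourier_one, fourier_one] at h1
  exact AddCircle.injective_toCircle one_ne_zero (Subtype.ext h1)

theorem isSmoothEmbeddingIn_trigFun (S : Finset (Fin n → ℤ)) (hS : ∀ i, Pi.single i 1 ∈ S) :
    IsSmoothEmbeddingIn 𝓘(ℝ, Fin n → ℝ)
      (fun (x : UnitAddTorus (Fin n)) (p : S × Bool) => trigFun p.1.1 p.2 x) := by
  have hsm : ContDiff ℝ ∞ ((fun (x : UnitAddTorus (Fin n)) (p : S × Bool) => trigFun p.1.1 p.2 x) ∘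
      torusMk n) := by
    rw [contDiff_pi]
    rintro ⟨k, b⟩
    cases b
    · simp only [Function.comp_apply, trigFun_false]
      exact (phase n k.1).contDiff.sin
    · simp only [Function.comp_apply, trigFun_true]
      exact (phase n k.1).contDiff.cos
  refine ⟨contMDiff_of_comp_torusMk hsm, fun x => ?_, ?_⟩
  · rw [mfderiv_torus_eq hsm]
    set y := extChartAt 𝓘(ℝ, Fin n → ℝ) x x
    have hd : ∀ (w : Fin n → ℝ) (p : S × Bool),
        fderiv ℝ ((fun (x : UnitAddTorus (Fin n)) (p : S × Bool) => trigFun p.1.1 p.2 x) ∘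
          torusMk n) y w p = fderiv ℝ (fun y => trigFun p.1.1 p.2 (torusMk n y)) y w := by
      intro w p
      have h1 := (hasFDerivAt_pi'.1 (hsm.differentiable (by simp) y).hasFDerivAt p).fderiv
      exact (DFunLike.congr_fun h1 w).symm
    suffices hinj : ∀ w : Fin n → ℝ, (∀ p : S × Bool,
        fderiv ℝ (fun y => trigFun p.1.1 p.2 (torusMk n y)) y w = 0) → w = 0 from
      (injective_iff_map_eq_zero _).2 fun w hw => hinj w fun p => (hd w p).symm.trans (congrFun hw p)
    intro w hw'
    funext i
    have h1 := hw' (⟨_, hS i⟩, true)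
    have h2 := hw' (⟨_, hS i⟩, false)
    simp only [trigFun_true, trigFun_false] at h1 h2
    rw [((phase n (Pi.single i 1)).hasFDerivAt.cos).fderiv] at h1
    rw [((phase n (Pi.single i 1)).hasFDerivAt.sin).fderiv] at h2
    simp only [smul_apply, smul_eq_mul] at h1 h2
    have h3 : phase n (Pi.single i 1) w = 0 := by
      have := Real.sin_sq_add_cos_sq (phase n (Pi.single i 1) y)
      calc phase n (Pi.single i 1) w = (Real.sin (phase n (Pi.single i 1) y) ^ 2 +
          Real.cos (phase n (Pi.single i 1) y) ^ 2) * phase n (Pi.single i 1) w := by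
            rw [this, one_mul]
        _ = 0 := by linear_combination - Real.sin (phase n (Pi.single i 1) y) * h1 +
            Real.cos (phase n (Pi.single i 1) y) * h2
    rw [phase_single] at h3
    simpa [Real.pi_ne_zero] using h3
  · refine (Continuous.isClosedEmbedding (contMDiff_of_comp_torusMk hsm).continuous
      fun x x' hxx' => ?_).isEmbedding
    exact eq_of_trigFun_eq fun i b => congrFun hxx' (⟨_, hS i⟩, b)

/-- The trigonometric polynomial with frequencies in `s` and coefficients `a`, `b`. -/
noncomputable def trigField (s : Finset (Fin n → ℤ)) (a b : (Fin n → ℤ) → (Fin n → ℝ))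
    (y : Fin n → ℝ) : Fin n → ℝ :=
  ∑ k ∈ s, (Real.sin (phase n k y) • a k + Real.cos (phase n k y) • b k)

theorem contDiff_trigField (s : Finset (Fin n → ℤ)) (a b : (Fin n → ℤ) → (Fin n → ℝ)) :
    ContDiff ℝ 1 (trigField s a b) :=
  ContDiff.sum fun k _ => ((phase n k).contDiff.sin.smul contDiff_const).add
    ((phase n k).contDiff.cos.smul contDiff_const)

theorem lipschitzWith_trigField (s : Finset (Fin n → ℤ)) (a b : (Fin n → ℤ) → (Fin n → ℝ)) :
    ∃ K, LipschitzWith K (trigField s a b) := by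
  have key : ∀ {g : ℝ → ℝ}, LipschitzWith 1 g → ∀ (k : Fin n → ℤ) (c : Fin n → ℝ),
      ∃ K, LipschitzWith K fun y => g (phase n k y) • c := fun hg k c =>
    ⟨_, (ContinuousLinearMap.toSpanSingleton ℝ c).lipschitz.comp (hg.comp (phase n k).lipschitz)⟩
  induction s using Finset.cons_induction with
  | empty => exact ⟨0, LipschitzWith.const (0 : Fin n → ℝ)⟩
  | cons k s hk ih =>
    obtain ⟨K, hK⟩ := ih
    obtain ⟨K1, h1⟩ := key Real.lipschitzWith_sin k (a k)
    obtain ⟨K2, h2⟩ := key Real.lipschitzWith_cos k (b k)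
    have : trigField (Finset.cons k s hk) a b = fun y =>
        (Real.sin (phase n k y) • a k + Real.cos (phase n k y) • b k) + trigField s a b y :=
      funext fun y => Finset.sum_cons hk
    rw [this]
    exact ⟨_, (h1.add h2).add hK⟩

theorem norm_trigField_le (s : Finset (Fin n → ℤ)) (a b : (Fin n → ℤ) → (Fin n → ℝ))
    (y : Fin n → ℝ) : ‖trigField s a b y‖ ≤ (∑ k ∈ s, (‖a k‖₊ + ‖b k‖₊) : ℝ≥0) := by
  push_cast
  refine norm_sum_le_of_le s fun k _ => ?_
  refine (norm_add_le _ _).trans (add_le_add ?_ ?_)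
  · rw [norm_smul]
    exact mul_le_of_le_one_left (norm_nonneg _) (Real.abs_sin_le_one _)
  · rw [norm_smul]
    exact mul_le_of_le_one_left (norm_nonneg _) (Real.abs_cos_le_one _)

theorem embedsInEuler_torus {X : (x : UnitAddTorus (Fin n)) → TangentSpace 𝓘(ℝ, Fin n → ℝ) x}
    (hX : IsTrigPolynomialField n X) : EmbedsInEuler 𝓘(ℝ, Fin n → ℝ) X := by
  classical
  obtain ⟨s, a₀, b₀, hX⟩ := hX
  -- enlarge the set of frequencies so that it contains the coordinate ones
  let S : Finset (Fin n → ℤ) := s ∪ Finset.univ.image fun i => Pi.single i 1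
  have hS : ∀ i : Fin n, Pi.single i 1 ∈ S := fun i =>
    Finset.mem_union_right _ (Finset.mem_image_of_mem _ (Finset.mem_univ i))
  let a : (Fin n → ℤ) → (Fin n → ℝ) := fun k => if k ∈ s then a₀ k else 0
  let b : (Fin n → ℤ) → (Fin n → ℝ) := fun k => if k ∈ s then b₀ k else 0
  have hXS : ∀ y, X (torusMk n y) =
      mfderiv 𝓘(ℝ, Fin n → ℝ) 𝓘(ℝ, Fin n → ℝ) (torusMk n) y (trigField S a b y) := by
    intro y
    rw [hX]
    congr 1
    have h1 : trigField S a b y = trigField s a b y :=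
      (Finset.sum_subset Finset.subset_union_left fun k _ hk => by simp [a, b, hk]).symm
    refine Eq.trans ?_ h1.symm
    refine Finset.sum_congr rfl fun k hk => ?_
    simp only [a, b, if_pos hk, phase_apply]
    rfl
  obtain ⟨K, hK⟩ := lipschitzWith_trigField S a b
  choose lift hlift using torusMk_surjective n
  choose γ hγ0 hγ using fun x => exists_global_solution (contDiff_trigField S a b) hK
    (norm_trigField_le S a b) (lift x)
  have hφ : IsGlobalFlow X fun t x => torusMk n (γ x t) := by
    refine ⟨fun x => (congrArg (torusMk n) (hγ0 x)).trans (hlift x), fun x t => ?_⟩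
    have h1 := ((torusMk_contMDiff n).mdifferentiable (by simp) (γ x t)).hasMFDerivAt.comp t
      (hγ x t).hasFDerivAt.hasMFDerivAt
    refine h1.congr_mfderiv ?_
    apply ContinuousLinearMap.ext
    intro r
    rw [hXS]
    exact ContinuousLinearMap.map_smul
      (mfderiv 𝓘(ℝ, Fin n → ℝ) 𝓘(ℝ, Fin n → ℝ) (torusMk n) (γ x t) :
        (Fin n → ℝ) →L[ℝ] (Fin n → ℝ)) r (trigField S a b (γ x t))
  -- `ℓ k` computes the angular speed `2π k·X` from the values of the trigonometric functions
  let ℓ : (Fin n → ℤ) → (S × Bool → ℝ) →ₗ[ℝ] ℝ := fun k =>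
    ∑ p : S × Bool, phase n k (if p.2 then b p.1 else a p.1) • LinearMap.proj p
  have hℓ : ∀ k y, ℓ k (fun p => trigFun p.1.1 p.2 (torusMk n y)) =
      phase n k (trigField S a b y) := by
    intro k y
    simp only [ℓ, LinearMap.sum_apply, smul_eq_mul, Fintype.sum_prod_type, Fintype.sum_bool,
      trigField, map_sum, map_add, map_smul]
    rw [← Finset.sum_coe_sort S]
    refine Finset.sum_congr rfl fun p _ => ?_
    simp [trigFun_true, trigFun_false]
    ring
  refine embedsInEuler_of_antisymm hφ (isSmoothEmbeddingIn_trigFun S hS)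
    (fun p q => if p.1 = q.1 then (if p.2 then (if q.2 then 0 else - ℓ p.1)
      else (if q.2 then ℓ p.1 else 0)) else 0) ?_ ?_
  · rintro ⟨k, i⟩ ⟨l, j⟩
    by_cases h : k = l
    · subst h
      cases i <;> cases j <;> simp
    · simp [h, Ne.symm h]
  · rintro x t ⟨k, i⟩
    have h1 : HasDerivAt (fun t => phase n k (γ x t)) (phase n k (trigField S a b (γ x t))) t :=
      (phase n k).hasFDerivAt.comp_hasDerivAt t (hγ x t)
    rw [Fintype.sum_prod_type, Finset.sum_eq_single k]
    · cases i
      · simp only [trigFun_false, Fintype.sum_bool]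
        refine h1.sin.congr_deriv ?_
        simp [hℓ, trigFun_true, mul_comm]
      · simp only [trigFun_true, Fintype.sum_bool]
        refine h1.cos.congr_deriv ?_
        simp [hℓ, trigFun_false, mul_comm]
    · intro l _ hl
      simp [Ne.symm hl]
    · simp

end Torus

/-! ### Products of coordinates -/

section PolynomialFlow

/-- The products of `m` factors taken among `1` and the coordinates of `y`, that is, the entries of the
tensor power `(1, y)^{⊗ m}`; the index `none` stands for the factor `1`. All the sequences of
factors are kept, so that skew matrices act on the family by skew matrices. -/
def coordProd {σ : Type} (m : ℕ) (y : σ → ℝ) (κ : Fin m → Option σ) : ℝ :=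
  ∏ j, (κ j).elim 1 y

theorem coordProd_cons {σ : Type} {m : ℕ} (y : σ → ℝ) (α : Option σ) (κ : Fin m → Option σ) :
    coordProd (m + 1) y (Fin.cons α κ) = α.elim 1 y * coordProd m y κ := by
  simp [coordProd, Fin.prod_univ_succ]

theorem coordProd_const_none {σ : Type} (m : ℕ) (y : σ → ℝ) :
    coordProd m y (fun _ => none) = 1 := by
  simp [coordProd]

/-- A polynomial is a linear combination of the products of `m` factors, for all large `m`. -/
theorem eventually_exists_linear_coordProd {σ : Type} (q : MvPolynomial σ ℝ) :
    ∀ᶠ m in atTop, ∃ ℓ : ((Fin m → Option σ) → ℝ) →ₗ[ℝ] ℝ,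
      ∀ y, ℓ (coordProd m y) = MvPolynomial.eval y q := by
  induction q using MvPolynomial.induction_on with
  | C r =>
    refine .of_forall fun m => ⟨r • LinearMap.proj fun _ => none, fun y => ?_⟩
    simp [coordProd_const_none]
  | add p q hp hq =>
    filter_upwards [hp, hq] with m ⟨ℓ, h⟩ ⟨ℓ', h'⟩
    exact ⟨ℓ + ℓ', fun y => by simp [h, h']⟩
  | mul_X p i hp =>
    obtain ⟨m₀, h⟩ := eventually_atTop.1 hp
    refine eventually_atTop.2 ⟨m₀ + 1, fun m hm => ?_⟩
    obtain ⟨k, rfl⟩ : ∃ k, m = k + 1 := ⟨m - 1, by omega⟩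
    obtain ⟨ℓ, hℓ⟩ := h k (by omega)
    let c : (Fin k → Option σ) → (Fin (k + 1) → Option σ) := fun κ => Fin.cons (some i) κ
    refine ⟨ℓ ∘ₗ LinearMap.funLeft ℝ ℝ c, fun y => ?_⟩
    have : LinearMap.funLeft ℝ ℝ c (coordProd (k + 1) y) = y i • coordProd k y := by
      funext κ
      simp [c, LinearMap.funLeft_apply, coordProd_cons]
    rw [LinearMap.comp_apply, this, map_smul, hℓ]
    simp [mul_comm]

theorem contDiff_coordProd {σ : Type} [Fintype σ] (m : ℕ) :
    ContDiff ℝ ∞ (coordProd m : (σ → ℝ) → _) := by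
  rw [contDiff_pi]
  intro κ
  refine contDiff_prod fun j _ => ?_
  cases κ j
  · exact contDiff_const
  · exact contDiff_apply ℝ ℝ _

theorem contDiff_mvPolynomial_eval {σ : Type} [Fintype σ] (q : MvPolynomial σ ℝ) :
    ContDiff ℝ ∞ fun y : σ → ℝ => MvPolynomial.eval y q := by
  obtain ⟨m, ℓ, h⟩ := (eventually_exists_linear_coordProd q).exists
  simp only [← h]
  exact (LinearMap.toContinuousLinearMap ℓ).contDiff.comp (contDiff_coordProd m)

variable {σ : Type}

open Classical in
/-- The matrix of the derivation of the `m`-th tensor power induced by the matrix `w`: it links the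
indices `κ` and `μ` when they differ in at most one place `j`, with coefficient `w (κ j) (μ j)`. The
entries of `w` may lie in any additive group. -/
noncomputable def productCoeff {R : Type} [AddCommGroup R] (m : ℕ) (w : Option σ → Option σ → R)
    (κ μ : Fin m → Option σ) : R :=
  ∑ j, if ∀ k, k ≠ j → μ k = κ k then w (κ j) (μ j) else 0

theorem productCoeff_antisymm {R : Type} [AddCommGroup R] {m : ℕ} {w : Option σ → Option σ → R}
    (hw : ∀ α β, w α β = - w β α) (κ μ : Fin m → Option σ) :
    productCoeff m w κ μ = - productCoeff m w μ κ := by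
  rw [productCoeff, productCoeff, ← Finset.sum_neg_distrib]
  refine Finset.sum_congr rfl fun j _ => ?_
  have : (∀ k, k ≠ j → μ k = κ k) ↔ (∀ k, k ≠ j → κ k = μ k) :=
    forall₂_congr fun _ _ => eq_comm
  by_cases h : ∀ k, k ≠ j → μ k = κ k
  · rw [if_pos h, if_pos (this.1 h), hw]
  · rw [if_neg h, if_neg (fun h' => h (this.2 h')), neg_zero]

/-- If `(1, γ)' = w (1, γ)` at the time `t`, then the tensor power is differentiated by the derivation
induced by `w`. -/
theorem hasDerivAt_coordProd [Fintype σ] {m : ℕ} {w : Option σ → Option σ → ℝ} {γ : ℝ → σ → ℝ} {t : ℝ}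
    (hγ : ∀ α, HasDerivAt (fun t => α.elim 1 (γ t)) (∑ β, w α β * β.elim 1 (γ t)) t)
    (κ : Fin m → Option σ) :
    HasDerivAt (fun t => coordProd m (γ t) κ)
      (∑ μ, productCoeff m w κ μ * coordProd m (γ t) μ) t := by
  classical
  have h := HasDerivAt.fun_finsetProd (u := Finset.univ) fun (j : Fin m) _ => hγ (κ j)
  refine h.congr_deriv ?_
  simp only [productCoeff, Finset.sum_mul]
  rw [Finset.sum_comm]
  refine Finset.sum_congr rfl fun j _ => ?_
  simp only [ite_mul, zero_mul]
  rw [← Finset.sum_filter, smul_eq_mul, Finset.mul_sum]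
  refine Finset.sum_bij' (fun β _ => Function.update κ j β) (fun μ _ => μ j) ?_ ?_ ?_ ?_ ?_
  · intro β _
    simp +contextual [Function.update_of_ne]
  · intro μ _
    exact Finset.mem_univ _
  · intro β _
    simp
  · intro μ hμ
    funext k
    by_cases hk : k = j
    · subst hk; simp
    · rw [Function.update_of_ne hk, (Finset.mem_filter.1 hμ).2 k hk]
  · intro β _
    rw [coordProd, ← Finset.mul_prod_erase _ _ (Finset.mem_univ j), Function.update_self]
    have : ∏ k ∈ Finset.univ.erase j, ((Function.update κ j β) k).elim 1 (γ t) =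
        ∏ k ∈ Finset.univ.erase j, (κ k).elim 1 (γ t) :=
      Finset.prod_congr rfl fun k hk => by rw [Function.update_of_ne (Finset.ne_of_mem_erase hk)]
    rw [this]
    ring

end PolynomialFlow

/-! ### Polynomial vector fields on the sphere -/

section Sphere

open MvPolynomial

variable {n : ℕ}

theorem fact_finrank_euclideanSpace (n : ℕ) :
    Fact (Module.finrank ℝ (EuclideanSpace ℝ (Fin (n + 1))) = n + 1) :=
  ⟨finrank_euclideanSpace_fin⟩

attribute [local instance] fact_finrank_euclideanSpace

theorem sum_sq_of_mem_sphere (x : NSphere n) :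
    ∑ i, (x : EuclideanSpace ℝ (Fin (n + 1))) i * (x : EuclideanSpace ℝ (Fin (n + 1))) i = 1 := by
  have h := EuclideanSpace.real_norm_sq_eq (x : EuclideanSpace ℝ (Fin (n + 1)))
  rw [norm_eq_of_mem_sphere x] at h
  simpa [pow_two] using h.symm

/-- Tangency to the sphere: `P(x) · x = 0`. -/
theorem sum_mul_eval_eq_zero {X : (x : NSphere n) → TangentSpace (𝓡 n) x}
    {P : Fin (n + 1) → MvPolynomial (Fin (n + 1)) ℝ} (x : NSphere n)
    (hP : ∀ i, mvfderiv (𝓡 n) (fun z : NSphere n => (z : EuclideanSpace ℝ (Fin (n + 1)))) x (X x) i =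
      eval (fun j => (x : EuclideanSpace ℝ (Fin (n + 1))) j) (P i)) :
    ∑ i, eval (fun j => (x : EuclideanSpace ℝ (Fin (n + 1))) j) (P i) *
      (x : EuclideanSpace ℝ (Fin (n + 1))) i = 0 := by
  have h : mvfderiv (𝓡 n) (fun z : NSphere n => (z : EuclideanSpace ℝ (Fin (n + 1)))) x (X x) ∈
      (ℝ ∙ (x : EuclideanSpace ℝ (Fin (n + 1))))ᗮ := by
    rw [← range_mvfderiv_subtypeVal (n := n) x]
    exact ⟨X x, rfl⟩
  have h2 := Submodule.mem_orthogonal_singleton_iff_inner_right.1 h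
  rw [PiLp.inner_apply] at h2
  simpa [hP] using h2

theorem contDiff_coord (i : Fin (n + 1)) :
    ContDiff ℝ ∞ fun y : EuclideanSpace ℝ (Fin (n + 1)) => y i :=
  (EuclideanSpace.proj i : EuclideanSpace ℝ (Fin (n + 1)) →L[ℝ] ℝ).contDiff

/-- The entries of the skew matrix of polynomials `P xᵀ - x Pᵀ`. -/
noncomputable def tangentRotation (P : Fin (n + 1) → MvPolynomial (Fin (n + 1)) ℝ)
    (i l : Fin (n + 1)) : MvPolynomial (Fin (n + 1)) ℝ := P i * X l - X i * P l

theorem tangentRotation_antisymm (P : Fin (n + 1) → MvPolynomial (Fin (n + 1)) ℝ)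
    (i l : Fin (n + 1)) : tangentRotation P i l = - tangentRotation P l i := by
  rw [tangentRotation, tangentRotation]
  ring

/-- The vector field `y ↦ (P yᵀ - y Pᵀ) y` on `ℝ^(n+1)`, tangent to all the spheres centred at `0`. -/
noncomputable def rotationField (P : Fin (n + 1) → MvPolynomial (Fin (n + 1)) ℝ)
    (y : EuclideanSpace ℝ (Fin (n + 1))) : EuclideanSpace ℝ (Fin (n + 1)) :=
  WithLp.toLp 2 fun i => ∑ l, eval y (tangentRotation P i l) * y l

theorem rotationField_apply (P : Fin (n + 1) → MvPolynomial (Fin (n + 1)) ℝ)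
    (y : EuclideanSpace ℝ (Fin (n + 1))) (i : Fin (n + 1)) :
    rotationField P y i = ∑ l, eval y (tangentRotation P i l) * y l := rfl

theorem contDiff_rotationField (P : Fin (n + 1) → MvPolynomial (Fin (n + 1)) ℝ) :
    ContDiff ℝ ∞ (rotationField P) := by
  rw [contDiff_euclidean]
  intro i
  simp only [rotationField_apply]
  exact ContDiff.sum fun l _ => ((contDiff_mvPolynomial_eval (tangentRotation P i l)).comp
    (f := fun y : EuclideanSpace ℝ (Fin (n + 1)) => (y : Fin (n + 1) → ℝ))
    (contDiff_pi.2 contDiff_coord)).mul (contDiff_coord l)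

theorem inner_rotationField_self (P : Fin (n + 1) → MvPolynomial (Fin (n + 1)) ℝ)
    (y : EuclideanSpace ℝ (Fin (n + 1))) : inner ℝ y (rotationField P y) = 0 := by
  have h : inner ℝ y (rotationField P y) =
      ∑ i, ∑ l, eval y (tangentRotation P i l) * y l * y i := by
    rw [PiLp.inner_apply]
    refine Finset.sum_congr rfl fun i _ => ?_
    rw [rotationField_apply, ← Finset.sum_mul]
    rfl
  have h2 : inner ℝ y (rotationField P y) = - inner ℝ y (rotationField P y) := by
    conv_lhs => rw [h, Finset.sum_comm]
    rw [h, ← Finset.sum_neg_distrib]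
    refine Finset.sum_congr rfl fun i _ => ?_
    rw [← Finset.sum_neg_distrib]
    refine Finset.sum_congr rfl fun l _ => ?_
    rw [tangentRotation_antisymm P l i, map_neg]
    ring
  linarith

/-- On the sphere, `(P xᵀ - x Pᵀ) x = |x|² P(x) - (P(x) · x) x = P(x)`. -/
theorem rotationField_eq {X : (x : NSphere n) → TangentSpace (𝓡 n) x}
    {P : Fin (n + 1) → MvPolynomial (Fin (n + 1)) ℝ} (x : NSphere n)
    (hP : ∀ i, mvfderiv (𝓡 n) (fun z : NSphere n => (z : EuclideanSpace ℝ (Fin (n + 1)))) x (X x) i =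
      eval (fun j => (x : EuclideanSpace ℝ (Fin (n + 1))) j) (P i)) :
    rotationField P x =
      mvfderiv (𝓡 n) (fun z : NSphere n => (z : EuclideanSpace ℝ (Fin (n + 1)))) x (X x) := by
  ext i
  have h1 := sum_mul_eval_eq_zero x hP
  have h2 := sum_sq_of_mem_sphere x
  rw [hP, rotationField_apply]
  simp only [tangentRotation, map_sub, map_mul, eval_X, sub_mul, Finset.sum_sub_distrib]
  simp only [mul_assoc, ← Finset.mul_sum]
  rw [h1, h2]
  ring

/-- The tangent field is complete on the unit sphere: it is multiplied by a cutoff function to become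
bounded and Lipschitz on `ℝ^(n+1)`, which does not affect the solutions on the sphere. -/
theorem exists_solution_sphere (P : Fin (n + 1) → MvPolynomial (Fin (n + 1)) ℝ) (x : NSphere n) :
    ∃ γ : ℝ → EuclideanSpace ℝ (Fin (n + 1)), γ 0 = x ∧ (∀ t, γ t ∈ Metric.sphere 0 1) ∧
      ∀ t, HasDerivAt γ (rotationField P (γ t)) t := by
  let b : ContDiffBump (0 : EuclideanSpace ℝ (Fin (n + 1))) := ⟨1, 2, one_pos, one_lt_two⟩
  let v : EuclideanSpace ℝ (Fin (n + 1)) → EuclideanSpace ℝ (Fin (n + 1)) := fun y =>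
    b y • rotationField P y
  have hv : ContDiff ℝ 1 v :=
    b.contDiff.smul ((contDiff_rotationField P).of_le (by norm_cast))
  have hs : HasCompactSupport v := b.hasCompactSupport.smul_right
  obtain ⟨K, hK⟩ := hv.lipschitzWith_of_hasCompactSupport hs one_ne_zero
  obtain ⟨L, hL⟩ := hs.exists_bound_of_continuous hv.continuous
  obtain ⟨γ, h0, hγ⟩ := exists_global_solution hv hK (L := L.toNNReal)
    (fun y => (hL y).trans (Real.le_coe_toNNReal L)) (x : EuclideanSpace ℝ (Fin (n + 1)))
  have hnorm : ∀ t, ‖γ t‖ ^ 2 = 1 := by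
    have hd : ∀ t, HasDerivAt (fun t => ‖γ t‖ ^ 2) 0 t := by
      intro t
      refine (hγ t).norm_sq.congr_deriv ?_
      simp only [v, inner_smul_right, inner_rotationField_self, mul_zero]
    intro t
    rw [is_const_of_deriv_eq_zero (fun t => (hd t).differentiableAt) (fun t => (hd t).deriv) t 0,
      h0, norm_eq_of_mem_sphere x, one_pow]
  have hmem : ∀ t, γ t ∈ Metric.sphere (0 : EuclideanSpace ℝ (Fin (n + 1))) 1 := by
    intro t
    rw [mem_sphere_zero_iff_norm]
    exact (pow_eq_one_iff_of_nonneg (norm_nonneg _) two_ne_zero).1 (hnorm t)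
  refine ⟨γ, h0, hmem, fun t => (hγ t).congr_deriv ?_⟩
  have : b (γ t) = 1 := b.one_of_mem_closedBall (Metric.sphere_subset_closedBall (hmem t))
  simp only [v, this, one_smul]

theorem isMIntegralCurve_sphere {X : (x : NSphere n) → TangentSpace (𝓡 n) x}
    {γ : ℝ → EuclideanSpace ℝ (Fin (n + 1))} (hmem : ∀ t, γ t ∈ Metric.sphere 0 1)
    (hC : ContDiff ℝ 1 γ)
    (hγ : ∀ t, HasDerivAt γ (mvfderiv (𝓡 n)
      (fun z : NSphere n => (z : EuclideanSpace ℝ (Fin (n + 1)))) ⟨γ t, hmem t⟩ (X ⟨γ t, hmem t⟩)) t) :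
    IsMIntegralCurve (fun t => (⟨γ t, hmem t⟩ : NSphere n)) X := by
  intro t
  have hc : ContMDiff 𝓘(ℝ, ℝ) (𝓡 n) 1 (fun t => (⟨γ t, hmem t⟩ : NSphere n)) :=
    ContMDiff.codRestrict_sphere hC.contMDiff hmem
  have h1 := (hc.mdifferentiable one_ne_zero t).hasMFDerivAt
  refine h1.congr_mfderiv ?_
  have h2 := hasMFDerivAt_unique (((contMDiff_coe_sphere (m := ∞) (n := n)
    (E := EuclideanSpace ℝ (Fin (n + 1)))).mdifferentiable (by simp)
      ⟨γ t, hmem t⟩).hasMFDerivAt.comp t h1) (hγ t).hasFDerivAt.hasMFDerivAt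
  apply ContinuousLinearMap.ext
  intro r
  apply injective_mvfderiv_subtypeVal_sphere (n := n) (⟨γ t, hmem t⟩ : NSphere n)
  refine (DFunLike.congr_fun h2 r).trans ?_
  exact (ContinuousLinearMap.map_smul (mvfderiv (𝓡 n)
      (fun z : NSphere n => (z : EuclideanSpace ℝ (Fin (n + 1)))) ⟨γ t, hmem t⟩) r
      (X ⟨γ t, hmem t⟩)).symm

theorem isSmoothEmbeddingIn_coordProd {m : ℕ} (hm : 0 < m) :
    IsSmoothEmbeddingIn (𝓡 n) (fun x : NSphere n =>
      coordProd m (fun i => (x : EuclideanSpace ℝ (Fin (n + 1))) i)) := by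
  let G : EuclideanSpace ℝ (Fin (n + 1)) → (Fin m → Option (Fin (n + 1))) → ℝ :=
    fun y => coordProd m y
  have hG : ContDiff ℝ ∞ G :=
    (contDiff_coordProd m).comp (contDiff_pi.2 contDiff_coord)
  -- `x i` itself is the product of `x i` and of `m - 1` factors `1`
  let c : Fin (n + 1) → Fin m → Option (Fin (n + 1)) := fun i =>
    Function.update (fun _ => none) ⟨0, hm⟩ (some i)
  have hc : ∀ y i, G y (c i) = y i := by
    intro y i
    change ∏ j, (Function.update (fun _ => none) (⟨0, hm⟩ : Fin m) (some i) j).elim 1 y = y i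
    rw [Finset.prod_eq_single ⟨0, hm⟩]
    · simp
    · intro j _ hj
      simp [Function.update_of_ne hj]
    · simp
  have hinj : ∀ y w, fderiv ℝ G y w = 0 → w = 0 := by
    intro y w hw
    ext i
    have h1 := hasFDerivAt_pi'.1 (hG.differentiable (by simp) y).hasFDerivAt (c i)
    simp only [hc] at h1
    have h2 : HasFDerivAt (fun y : EuclideanSpace ℝ (Fin (n + 1)) => y i)
      (EuclideanSpace.proj i : EuclideanSpace ℝ (Fin (n + 1)) →L[ℝ] ℝ) y :=
        (EuclideanSpace.proj i : EuclideanSpace ℝ (Fin (n + 1)) →L[ℝ] ℝ).hasFDerivAt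
    have h3 := DFunLike.congr_fun (h1.unique h2) w
    exact h3.symm.trans (congrFun hw (c i))
  have hsm : ContMDiff (𝓡 n) 𝓘(ℝ, (Fin m → Option (Fin (n + 1))) → ℝ) ∞
      (fun x : NSphere n => G x) := hG.contMDiff.comp contMDiff_coe_sphere
  refine ⟨hsm, fun x => ?_, ?_⟩
  · have h := ((hG.differentiable (by simp)
      (x : EuclideanSpace ℝ (Fin (n + 1)))).hasFDerivAt.hasMFDerivAt).comp x
        (((contMDiff_coe_sphere (n := n) (m := ∞)).mdifferentiable (by simp)) x).hasMFDerivAt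
    have h' : HasMFDerivAt (𝓡 n) 𝓘(ℝ, (Fin m → Option (Fin (n + 1))) → ℝ)
      (fun x : NSphere n => G x) x _ := h
    refine h'.mfderiv ▸ ?_
    refine Function.Injective.comp (g := fderiv ℝ G x) ?_
      (injective_mvfderiv_subtypeVal_sphere (n := n) x)
    exact (injective_iff_map_eq_zero _).2 (hinj _)
  · refine (Continuous.isClosedEmbedding hsm.continuous fun x x' hxx' => ?_).isEmbedding
    apply Subtype.ext
    ext i
    rw [← hc, ← hc]
    exact congrFun hxx' _

theorem embedsInEuler_sphere {X : (x : NSphere n) → TangentSpace (𝓡 n) x}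
    (hX : IsPolynomialField n X) : EmbedsInEuler (𝓡 n) X := by
  obtain ⟨P, hP⟩ := hX
  choose γ h0 hmem hγ using exists_solution_sphere P
  have hφ : IsGlobalFlow X fun t x => (⟨γ x t, hmem x t⟩ : NSphere n) := by
    refine ⟨fun x => Subtype.ext (h0 x), fun x => isMIntegralCurve_sphere (hmem x) ?_ fun t => ?_⟩
    · refine contDiff_one_iff_deriv.2 ⟨fun t => (hγ x t).differentiableAt, ?_⟩
      have : deriv (γ x) = fun t => rotationField P (γ x t) := funext fun t => (hγ x t).deriv
      rw [this]
      exact (contDiff_rotationField P).continuous.comp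
        (continuous_iff_continuousAt.2 fun t => (hγ x t).continuousAt)
    · exact (hγ x t).congr_deriv (rotationField_eq ⟨γ x t, hmem x t⟩ (hP _))
  have hev : ∀ᶠ m in atTop, ∀ i l : Fin (n + 1),
      ∃ ℓ : ((Fin m → Option (Fin (n + 1))) → ℝ) →ₗ[ℝ] ℝ,
        ∀ y, ℓ (coordProd m y) = eval y (tangentRotation P i l) :=
    eventually_all.2 fun i => eventually_all.2 fun l => eventually_exists_linear_coordProd _
  obtain ⟨m, hm, hm0⟩ := (hev.and (eventually_gt_atTop 0)).exists
  choose ℓ hℓ using hm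
  -- the entries of `P xᵀ - x Pᵀ` as linear forms in the products, antisymmetrized since the forms
  -- `ℓ i l` and `-ℓ l i` need only agree on the products
  let w : Option (Fin (n + 1)) → Option (Fin (n + 1)) →
      ((Fin m → Option (Fin (n + 1))) → ℝ) →ₗ[ℝ] ℝ := fun α β =>
    α.elim 0 fun i => β.elim 0 fun l => (1 / 2 : ℝ) • (ℓ i l - ℓ l i)
  have hw : ∀ α β, w α β = - w β α := by
    rintro (_ | i) (_ | l)
    · simp [w]
    · simp [w]
    · simp [w]
    · change (1 / 2 : ℝ) • (ℓ i l - ℓ l i) = - ((1 / 2 : ℝ) • (ℓ l i - ℓ i l))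
      module
  have hwv : ∀ i l y, w (some i) (some l) (coordProd m y) = eval y (tangentRotation P i l) := by
    intro i l y
    change (1 / 2 : ℝ) * (ℓ i l (coordProd m y) - ℓ l i (coordProd m y)) = _
    rw [hℓ, hℓ, tangentRotation_antisymm P l i, map_neg]
    ring
  refine embedsInEuler_of_antisymm hφ (isSmoothEmbeddingIn_coordProd hm0) (productCoeff m w)
    (productCoeff_antisymm hw) fun x t κ => ?_
  refine (hasDerivAt_coordProd (w := fun α β => w α β (coordProd m (γ x t)))
    (γ := fun t => (γ x t : Fin (n + 1) → ℝ)) ?_ κ).congr_deriv ?_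
  · rintro (_ | i)
    · simpa [w] using hasDerivAt_const t (1 : ℝ)
    · have h1 := (EuclideanSpace.proj i : EuclideanSpace ℝ (Fin (n + 1)) →L[ℝ] ℝ).hasFDerivAt.comp_hasDerivAt
        t (hγ x t)
      refine h1.congr_deriv ?_
      have hw0 : w (some i) none = 0 := rfl
      rw [Fintype.sum_option, hw0, LinearMap.zero_apply, zero_mul, zero_add]
      simp only [hwv]
      rfl
  · refine Finset.sum_congr rfl fun μ _ => ?_
    congr 1
    simp only [productCoeff, LinearMap.sum_apply]
    refine Finset.sum_congr rfl fun j _ => ?_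
    split_ifs <;> rfl

end Sphere

theorem theorem1p2 (n : ℕ) (hn : 1 ≤ n) :
    (∀ X : (x : NSphere n) → TangentSpace (𝓡 n) x,
      IsPolynomialField n X → EmbedsInEuler (𝓡 n) X) ∧
    (∀ X : (x : UnitAddTorus (Fin n)) → TangentSpace 𝓘(ℝ, Fin n → ℝ) x,
      IsTrigPolynomialField n X → EmbedsInEuler 𝓘(ℝ, Fin n → ℝ) X) :=
  ⟨fun _ => embedsInEuler_sphere, fun _ => embedsInEuler_torus⟩
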